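/- Let $k$ be an algebraically closed field of characteristic zero. All categories are $k$-linear abelian and finite (i.e. $k$-linearly equivalent to finite-dimensional modules over a finite-dimensional $k$-algebra). A finite multi-tensor category is such a category with a rigid monoidal structure with bilinear tensor product; it is a tensor category if its unit is simple. An $(\mathcal A,\mathcal B)$-bimodule category $\mathcal M$ is such a category with a left $\mathcal A$-action $\triangleright$ and a right $\mathcal B$-action $\triangleleft$, bilinear and exact in each variable, with their module associativity and unit constraints, and natural middle associativity constraints $(a\triangleright m)\triangleleft b\cong a\triangleright(m\triangleleft b)$ satisfying the two mixed pentagons. A (categorical) Morita context $(\mathcal A,\mathcal B,\mathcal M,\mathcal N,\odot,\boxdot,\alpha,\beta)$ consists of finite multi-tensor categories $\mathcal A,\mathcal B$; bimodule categories ${}_{\mathcal A}\mathcal M_{\mathcal B}$ and ${}_{\mathcal B}\mathcal N_{\mathcal A}$; a $\mathcal B$-balanced $\mathcal A$-bimodule functor $\odot\colon\mathcal M\times\mathcal N\to\mathcal A$ and an $\mathcal A$-balanced $\mathcal B$-bimodule functor $\boxdot\colon\mathcal N\times\mathcal M\to\mathcal B$, both bilinear and right exact in each variable (the mixed products; the bimodule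 structures $\phi\colon a\otimes(m\odot n)\cong(a\triangleright m)\odot n$, $\phi'\colon(m\odot n)\otimes a\cong m\odot(n\triangleleft a)$ and the balancing $(m\triangleleft b)\odot n\cong m\odot(b\triangleright n)$ are natural, satisfy the pentagon axioms and are compatible with one another; similarly $\psi,\psi'$ and the balancing for $\boxdot$); and balanced bimodule natural isomorphisms $$\alpha_{m,n,m'}\colon m\triangleleft(n\boxdot m')\to(m\odot n)\triangleright m',\qquad \beta_{n,m,n'}\colon n\triangleleft(m\odot n')\to(n\boxdot m)\triangleright n',$$ such that for all $m_1,m_2\in\mathcal M$, $n_1,n_2\in\mathcal N$ the composite $$(m_1\triangleleft(n_1\boxdot m_2))\odot n_2\xrightarrow{\alpha\odot\mathrm{id}}((m_1\odot n_1)\triangleright m_2)\odot n_2\xrightarrow{\phi^{-1}}(m_1\odot n_1)\otimes(m_2\odot n_2)\xrightarrow{\phi'}m_1\odot(n_1\triangleleft(m_2\odot n_2))\xrightarrow{\mathrm{id}\odot\beta}m_1\odot((n_1\boxdot m_2)\triangleright n_2)$$ is the balancing of $\odot$, and the same holds with the roles of $(\mathcal A,\mathcal M,\odot,\alpha)$ and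 $(\mathcal B,\mathcal N,\boxdot,\beta)$ exchanged. The context is strict if $\mathcal A,\mathcal B$ are strict monoidal, $\mathcal M,\mathcal N$ are strict bimodule categories, the bimodule functor structures and balancings of $\odot,\boxdot$ are identities, and $\alpha,\beta$ are identities. Theorem. (1) For every Morita context the following data satisfy the axioms of a bicategory $\mathbb M$: two objects $0,1$; Hom-categories $\mathbb M(0,0)=\mathcal A$, $\mathbb M(0,1)=\mathcal M$, $\mathbb M(1,0)=\mathcal N$, $\mathbb M(1,1)=\mathcal B$; identity 1-morphisms $\mathbf 1_{\mathcal A},\mathbf 1_{\mathcal B}$; horizontal composition (written in diagrammatic order) given by the eight functors $\otimes_{\mathcal A},\otimes_{\mathcal B}$, the four actions, $\odot$ and $\boxdot$; the sixteen associativity constraints given by the associators of $\mathcal A,\mathcal B$, the left, right and middle module constraints of $\mathcal M,\mathcal N$, the bimodule functor structures and balancings of $\odot,\boxdot$, and $\alpha,\beta$ (each or its inverse, according to direction); unit constraints those of $\mathcal A,\mathcal B,\mathcal M,\mathcal N$. (2) Every Morita context $C$ is equivalent to a strict Morita context $C'$: there are $k$-linear pseudo-functors in both directions between their bicategories whose two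 composites are pseudo-naturally equivalent to the identities. If $\mathcal A$ and $\mathcal B$ in $C$ are tensor categories, then $C'$ can be chosen so that its two multi-tensor categories are tensor categories as well. -/

import Mathlib

open CategoryTheory MonoidalCategory Limits
open scoped MonoidalLeftAction MonoidalRightAction

universe w v u

namespace Morita

set_option linter.checkUnivs false

/-! ### Linear functors and finite linear categories -/

section LinearCategories

variable (k : Type w) [Field k]

/-- `F` is `k`-linear and right exact. -/
structure IsRightExactLinear {C D : Type*} [Category* C] [Category* D] [Preadditive C]
    [Preadditive D] [Linear k C] [Linear k D] (F : C ⥤ D) : Prop where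
  additive : F.Additive
  linear : F.Linear k
  rightExact : PreservesFiniteColimits F

/-- `F` is `k`-linear and exact. -/
structure IsExactLinear {C D : Type*} [Category* C] [Category* D] [Preadditive C]
    [Preadditive D] [Linear k C] [Linear k D] (F : C ⥤ D) : Prop
    extends IsRightExactLinear k F where
  leftExact : PreservesFiniteLimits F

/-- A `k`-linear category is finite if it is `k`-linearly equivalent to the category of
finite-dimensional modules over a finite-dimensional `k`-algebra `R` (over such an `R` the
finite-dimensional modules are the finitely generated ones). -/
def IsFiniteLinear (C : Type*) [Category* C] [Preadditive C] [Linear k C] : Prop :=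
  ∃ (R : Type w) (_ : Ring R) (_ : Algebra k R) (_ : Module.Finite k R)
    (e : C ≌ FGModuleCat.{w} R), e.functor.Additive ∧ e.functor.Linear k

/-- A finite `k`-linear abelian category. -/
structure FinLinCat where
  /-- The type of objects. -/
  carrier : Type u
  [category : Category.{v} carrier]
  [abelian : Abelian carrier]
  [linear : Linear k carrier]
  finite : IsFiniteLinear k carrier

instance : CoeSort (FinLinCat.{w, v, u} k) (Type u) := ⟨FinLinCat.carrier⟩

attribute [instance] FinLinCat.category FinLinCat.abelian FinLinCat.linear

/-- A finite multi-tensor category over `k`: a finite `k`-linear abelian category with a rigid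
monoidal structure whose tensor product is bilinear. -/
structure FinMultitensorCat extends FinLinCat.{w, v, u} k where
  [monoidal : MonoidalCategory carrier]
  [monoidalPreadditive : MonoidalPreadditive carrier]
  [monoidalLinear : MonoidalLinear k carrier]
  [rigid : RigidCategory carrier]

instance : CoeSort (FinMultitensorCat.{w, v, u} k) (Type u) := ⟨fun A => A.carrier⟩

attribute [instance] FinMultitensorCat.monoidal FinMultitensorCat.monoidalPreadditive
  FinMultitensorCat.monoidalLinear FinMultitensorCat.rigid

end LinearCategories

variable {k : Type w} [Field k]

/-- A finite tensor category is a finite multi-tensor category with simple monoidal unit. -/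
def FinMultitensorCat.IsTensor (A : FinMultitensorCat.{w, v, u} k) : Prop :=
  Simple (𝟙_ A)

/-! ### Bimodule categories -/

/-- A finite `(A, B)`-bimodule category: a finite linear category with bilinear and biexact
left `A`-action `a ⊙ₗ m` and right `B`-action `m ⊙ᵣ b`, and natural middle associativity
constraints satisfying the two mixed pentagons. -/
structure BimoduleCat (A B : FinMultitensorCat.{w, v, u} k) extends FinLinCat.{w, v, u} k where
  [leftAction : MonoidalLeftAction A carrier]
  [rightAction : MonoidalRightAction B carrier]
  leftAction_exact (a : A) :
    IsExactLinear k ((MonoidalLeftAction.curriedAction A carrier).obj a)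
  leftAction_exact' (m : carrier) :
    IsExactLinear k ((MonoidalLeftAction.curriedAction A carrier).flip.obj m)
  rightAction_exact (b : B) :
    IsExactLinear k ((MonoidalRightAction.curriedAction B carrier).obj b)
  rightAction_exact' (m : carrier) :
    IsExactLinear k ((MonoidalRightAction.curriedAction B carrier).flip.obj m)
  /-- The middle associativity constraint. -/
  middle (a : A) (m : carrier) (b : B) : (a ⊙ₗ m) ⊙ᵣ b ≅ a ⊙ₗ (m ⊙ᵣ b)
  middle_naturality {a a' : A} {m m' : carrier} {b b' : B}
    (f : a ⟶ a') (g : m ⟶ m') (h : b ⟶ b') :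
    ((f ⊙ₗₘ g) ⊙ᵣₘ h) ≫ (middle a' m' b').hom = (middle a m b).hom ≫ (f ⊙ₗₘ (g ⊙ᵣₘ h))
  pentagon_left (a a' : A) (m : carrier) (b : B) :
    (αₗ a a' m).hom ⊵ᵣ b ≫ (middle a (a' ⊙ₗ m) b).hom ≫ a ⊴ₗ (middle a' m b).hom =
      (middle (a ⊗ a') m b).hom ≫ (αₗ a a' (m ⊙ᵣ b)).hom
  pentagon_right (a : A) (m : carrier) (b b' : B) :
    (middle a m b).hom ⊵ᵣ b' ≫ (middle a (m ⊙ᵣ b) b').hom =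
      (αᵣ (a ⊙ₗ m) b b').inv ≫ (middle a m (b ⊗ b')).hom ≫ a ⊴ₗ (αᵣ m b b').hom

instance (A B : FinMultitensorCat.{w, v, u} k) : CoeSort (BimoduleCat A B) (Type u) :=
  ⟨fun M => M.carrier⟩

attribute [instance] BimoduleCat.leftAction BimoduleCat.rightAction

/-! ### Mixed products -/

/-- The action of a functor `F : C ⥤ D ⥤ E` on a pair of morphisms. -/
def bimap {C D E : Type*} [Category* C] [Category* D] [Category* E] (F : C ⥤ D ⥤ E)
    {c c' : C} {d d' : D} (f : c ⟶ c') (g : d ⟶ d') :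
    (F.obj c).obj d ⟶ (F.obj c').obj d' :=
  (F.map f).app d ≫ (F.obj c').map g

/-- A `B`-balanced `A`-bimodule functor `M × N ⟶ A`, bilinear and right exact in each variable,
for an `(A, B)`-bimodule category `M` and a `(B, A)`-bimodule category `N`. -/
structure MixedProduct {A B : FinMultitensorCat.{w, v, u} k}
    (M : BimoduleCat A B) (N : BimoduleCat B A) where
  /-- The underlying functor of two variables. -/
  functor : M ⥤ N ⥤ A
  rightExact (m : M) : IsRightExactLinear k (functor.obj m)
  rightExact' (n : N) : IsRightExactLinear k (functor.flip.obj n)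
  /-- The left `A`-module functor structure. -/
  leftIso (a : A) (m : M) (n : N) :
    a ⊗ (functor.obj m).obj n ≅ (functor.obj (a ⊙ₗ m)).obj n
  /-- The right `A`-module functor structure. -/
  rightIso (m : M) (n : N) (a : A) :
    (functor.obj m).obj n ⊗ a ≅ (functor.obj m).obj (n ⊙ᵣ a)
  /-- The `B`-balancing. -/
  balancing (m : M) (b : B) (n : N) :
    (functor.obj (m ⊙ᵣ b)).obj n ≅ (functor.obj m).obj (b ⊙ₗ n)
  leftIso_naturality {a a' : A} {m m' : M} {n n' : N}
    (f : a ⟶ a') (g : m ⟶ m') (h : n ⟶ n') :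
    (f ⊗ₘ bimap functor g h) ≫ (leftIso a' m' n').hom =
      (leftIso a m n).hom ≫ bimap functor (f ⊙ₗₘ g) h
  rightIso_naturality {m m' : M} {n n' : N} {a a' : A}
    (f : m ⟶ m') (g : n ⟶ n') (h : a ⟶ a') :
    (bimap functor f g ⊗ₘ h) ≫ (rightIso m' n' a').hom =
      (rightIso m n a).hom ≫ bimap functor f (g ⊙ᵣₘ h)
  balancing_naturality {m m' : M} {b b' : B} {n n' : N}
    (f : m ⟶ m') (g : b ⟶ b') (h : n ⟶ n') :
    bimap functor (f ⊙ᵣₘ g) h ≫ (balancing m' b' n').hom =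
      (balancing m b n).hom ≫ bimap functor f (g ⊙ₗₘ h)
  leftIso_pentagon (a a' : A) (m : M) (n : N) :
    (leftIso (a ⊗ a') m n).hom ≫ (functor.map (αₗ a a' m).hom).app n =
      (α_ a a' ((functor.obj m).obj n)).hom ≫ a ◁ (leftIso a' m n).hom ≫
        (leftIso a (a' ⊙ₗ m) n).hom
  rightIso_pentagon (m : M) (n : N) (a a' : A) :
    (rightIso m n (a ⊗ a')).hom ≫ (functor.obj m).map (αᵣ n a a').hom =
      (α_ ((functor.obj m).obj n) a a').inv ≫ (rightIso m n a).hom ▷ a' ≫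
        (rightIso m (n ⊙ᵣ a) a').hom
  bimodule_pentagon (a : A) (m : M) (n : N) (a' : A) :
    (leftIso a m n).hom ▷ a' ≫ (rightIso (a ⊙ₗ m) n a').hom =
      (α_ a ((functor.obj m).obj n) a').hom ≫ a ◁ (rightIso m n a').hom ≫
        (leftIso a m (n ⊙ᵣ a')).hom
  balancing_pentagon (m : M) (b b' : B) (n : N) :
    (balancing m (b ⊗ b') n).hom ≫ (functor.obj m).map (αₗ b b' n).hom =
      (functor.map (αᵣ m b b').hom).app n ≫ (balancing (m ⊙ᵣ b) b' n).hom ≫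
        (balancing m b (b' ⊙ₗ n)).hom
  leftIso_balancing (a : A) (m : M) (b : B) (n : N) :
    (leftIso a (m ⊙ᵣ b) n).hom ≫ (functor.map (M.middle a m b).inv).app n ≫
        (balancing (a ⊙ₗ m) b n).hom =
      a ◁ (balancing m b n).hom ≫ (leftIso a m (b ⊙ₗ n)).hom
  rightIso_balancing (m : M) (b : B) (n : N) (a : A) :
    (rightIso (m ⊙ᵣ b) n a).hom ≫ (balancing m b (n ⊙ᵣ a)).hom =
      (balancing m b n).hom ▷ a ≫ (rightIso m (b ⊙ₗ n) a).hom ≫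
        (functor.obj m).map (N.middle b n a).hom

/-- The object `P(m, n)` of `A`. -/
abbrev MixedProduct.obj {A B : FinMultitensorCat.{w, v, u} k} {M : BimoduleCat A B}
    {N : BimoduleCat B A} (P : MixedProduct M N) (m : M) (n : N) : A :=
  (P.functor.obj m).obj n

/-- A balanced bimodule natural isomorphism `m ⊙ᵣ Q(n, m') ≅ P(m, n) ⊙ₗ m'` between the two
functors `M × N × M ⟶ M` obtained from mixed products `P : M × N ⟶ A`, `Q : N × M ⟶ B`. -/
structure MixedAssociator {A B : FinMultitensorCat.{w, v, u} k} {M : BimoduleCat A B}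
    {N : BimoduleCat B A} (P : MixedProduct M N) (Q : MixedProduct N M) where
  /-- The components. -/
  iso (m : M) (n : N) (m' : M) : m ⊙ᵣ Q.obj n m' ≅ P.obj m n ⊙ₗ m'
  naturality {m₁ m₂ : M} {n n' : N} {m₁' m₂' : M}
    (f : m₁ ⟶ m₂) (g : n ⟶ n') (h : m₁' ⟶ m₂') :
    (f ⊙ᵣₘ bimap Q.functor g h) ≫ (iso m₂ n' m₂').hom =
      (iso m₁ n m₁').hom ≫ (bimap P.functor f g ⊙ₗₘ h)
  left_linear (a : A) (m : M) (n : N) (m' : M) :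
    (iso (a ⊙ₗ m) n m').hom =
      (M.middle a m (Q.obj n m')).hom ≫ a ⊴ₗ (iso m n m').hom ≫
        (αₗ a (P.obj m n) m').inv ≫ (P.leftIso a m n).hom ⊵ₗ m'
  right_linear (m : M) (n : N) (m' : M) (b : B) :
    m ⊴ᵣ (Q.rightIso n m' b).hom ≫ (iso m n (m' ⊙ᵣ b)).hom =
      (αᵣ m (Q.obj n m') b).hom ≫ (iso m n m').hom ⊵ᵣ b ≫ (M.middle (P.obj m n) m' b).hom
  balanced_left (m : M) (b : B) (n : N) (m' : M) :
    (iso (m ⊙ᵣ b) n m').hom ≫ (P.balancing m b n).hom ⊵ₗ m' =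
      (αᵣ m b (Q.obj n m')).inv ≫ m ⊴ᵣ (Q.leftIso b n m').hom ≫ (iso m (b ⊙ₗ n) m').hom
  balanced_right (m : M) (n : N) (a : A) (m' : M) :
    (iso m (n ⊙ᵣ a) m').hom =
      m ⊴ᵣ (Q.balancing n a m').hom ≫ (iso m n (a ⊙ₗ m')).hom ≫
        (αₗ (P.obj m n) a m').inv ≫ (P.rightIso m n a).hom ⊵ₗ m'

/-- The pentagon relating the coherence isomorphisms `α` and `β` on `M × N × M × N`. -/
def MixedPentagon {A B : FinMultitensorCat.{w, v, u} k} {M : BimoduleCat A B}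
    {N : BimoduleCat B A} {P : MixedProduct M N} {Q : MixedProduct N M}
    (α : MixedAssociator P Q) (β : MixedAssociator Q P) : Prop :=
  ∀ (m₁ : M) (n₁ : N) (m₂ : M) (n₂ : N),
    (P.functor.map (α.iso m₁ n₁ m₂).hom).app n₂ ≫
        (P.leftIso (P.obj m₁ n₁) m₂ n₂).inv ≫
        (P.rightIso m₁ n₁ (P.obj m₂ n₂)).hom ≫
        (P.functor.obj m₁).map (β.iso n₁ m₂ n₂).hom =
      (P.balancing m₁ (Q.obj n₁ m₂) n₂).hom

/-! ### Morita contexts -/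

variable (k) in
/-- A categorical Morita context over `k`. -/
structure MoritaContext where
  /-- The first finite multi-tensor category. -/
  A : FinMultitensorCat.{w, v, u} k
  /-- The second finite multi-tensor category. -/
  B : FinMultitensorCat.{w, v, u} k
  /-- The `(A, B)`-bimodule category. -/
  M : BimoduleCat A B
  /-- The `(B, A)`-bimodule category. -/
  N : BimoduleCat B A
  /-- The `A`-valued mixed product `M × N ⟶ A`. -/
  P : MixedProduct M N
  /-- The `B`-valued mixed product `N × M ⟶ B`. -/
  Q : MixedProduct N M
  /-- The coherence isomorphism `m ⊙ᵣ Q(n, m') ≅ P(m, n) ⊙ₗ m'`. -/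
  α : MixedAssociator P Q
  /-- The coherence isomorphism `n ⊙ᵣ P(m, n') ≅ Q(n, m) ⊙ₗ n'`. -/
  β : MixedAssociator Q P
  pentagon : MixedPentagon α β
  pentagon' : MixedPentagon β α

/-- Both multi-tensor categories of the context are tensor categories. -/
def MoritaContext.IsTensor (C : MoritaContext.{w, v, u} k) : Prop :=
  C.A.IsTensor ∧ C.B.IsTensor

/-- An isomorphism is an identity: its ends are equal and it is the corresponding identity. -/
def IsIdentity {C : Type*} [Category* C] {X Y : C} (e : X ≅ Y) : Prop :=
  ∃ h : X = Y, e = eqToIso h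

/-- The monoidal category underlying `A` is strict. -/
structure FinMultitensorCat.IsStrict (A : FinMultitensorCat.{w, v, u} k) : Prop where
  associator (a b c : A) : IsIdentity (α_ a b c)
  leftUnitor (a : A) : IsIdentity (λ_ a)
  rightUnitor (a : A) : IsIdentity (ρ_ a)

/-- The bimodule category `M` is strict. -/
structure BimoduleCat.IsStrict {A B : FinMultitensorCat.{w, v, u} k}
    (M : BimoduleCat A B) : Prop where
  leftAssoc (a a' : A) (m : M) : IsIdentity (αₗ a a' m)
  leftUnit (m : M) : IsIdentity (MonoidalLeftAction.actionUnitIso (C := A) m)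
  rightAssoc (m : M) (b b' : B) : IsIdentity (αᵣ m b b')
  rightUnit (m : M) : IsIdentity (MonoidalRightAction.actionUnitIso (C := B) m)
  middle (a : A) (m : M) (b : B) : IsIdentity (M.middle a m b)

/-- The bimodule functor structure and the balancing of `P` are strict. -/
structure MixedProduct.IsStrict {A B : FinMultitensorCat.{w, v, u} k} {M : BimoduleCat A B}
    {N : BimoduleCat B A} (P : MixedProduct M N) : Prop where
  leftIso (a : A) (m : M) (n : N) : IsIdentity (P.leftIso a m n)
  rightIso (m : M) (n : N) (a : A) : IsIdentity (P.rightIso m n a)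
  balancing (m : M) (b : B) (n : N) : IsIdentity (P.balancing m b n)

/-- The Morita context `C` is strict. -/
structure MoritaContext.IsStrict (C : MoritaContext.{w, v, u} k) : Prop where
  A : C.A.IsStrict
  B : C.B.IsStrict
  M : C.M.IsStrict
  N : C.N.IsStrict
  P : C.P.IsStrict
  Q : C.Q.IsStrict
  α (m : C.M) (n : C.N) (m' : C.M) : IsIdentity (C.α.iso m n m')
  β (n : C.N) (m : C.M) (n' : C.N) : IsIdentity (C.β.iso n m n')

/-! ### The data of a bicategory, without its axioms -/

/-- The data of a bicategory with set of objects `O`: `Bicategory O` without its axioms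
(apart from those of the Hom-categories). -/
structure BicategoryData (O : Type) where
  /-- The objects of the Hom-categories. -/
  Hom : O → O → Type u
  /-- The Hom-categories. -/
  category : ∀ i j, Category.{v} (Hom i j)
  /-- The identity 1-morphisms. -/
  id : ∀ i, Hom i i
  /-- Horizontal composition of 1-morphisms, in diagrammatic order. -/
  comp : ∀ {i j l}, Hom i j → Hom j l → Hom i l
  /-- Left whiskering. -/
  whiskerLeft : ∀ {i j l} (f : Hom i j) {g h : Hom j l}, (g ⟶ h) → (comp f g ⟶ comp f h)
  /-- Right whiskering. -/
  whiskerRight : ∀ {i j l} {f g : Hom i j}, (f ⟶ g) → ∀ h : Hom j l, comp f h ⟶ comp g h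
  /-- The associativity constraints. -/
  associator : ∀ {h i j l} (x : Hom h i) (y : Hom i j) (z : Hom j l),
    comp (comp x y) z ≅ comp x (comp y z)
  /-- The left unit constraints. -/
  leftUnitor : ∀ {i j} (f : Hom i j), comp (id i) f ≅ f
  /-- The right unit constraints. -/
  rightUnitor : ∀ {i j} (f : Hom i j), comp f (id j) ≅ f

/-- The data of a bicategory. -/
def BicategoryData.ofBicategory {O : Type} (S : Bicategory.{v, u} O) : BicategoryData.{v, u} O where
  Hom i j := i ⟶ j
  category i j := S.homCategory i j
  id i := 𝟙 i
  comp f g := f ≫ g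
  whiskerLeft f _ _ η := S.whiskerLeft f η
  whiskerRight η h := S.whiskerRight η h
  associator x y z := S.associator x y z
  leftUnitor f := S.leftUnitor f
  rightUnitor f := S.rightUnitor f

/-- The data `D` form a bicategory. -/
def BicategoryData.IsBicategory {O : Type} (D : BicategoryData.{v, u} O) : Prop :=
  ∃ S : Bicategory.{v, u} O, BicategoryData.ofBicategory S = D

/-- The bicategory formed by data `D` that satisfy the axioms. -/
@[reducible]
def BicategoryData.IsBicategory.toBicategory {O : Type} {D : BicategoryData.{v, u} O}
    (hD : D.IsBicategory) : Bicategory.{v, u} O where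
  Hom := D.Hom
  id := D.id
  comp := D.comp
  homCategory := D.category
  whiskerLeft f _ _ η := D.whiskerLeft f η
  whiskerRight η h := D.whiskerRight η h
  associator := D.associator
  leftUnitor := D.leftUnitor
  rightUnitor := D.rightUnitor
  whiskerLeft_id := by obtain ⟨S, rfl⟩ := hD; exact S.whiskerLeft_id
  whiskerLeft_comp := by obtain ⟨S, rfl⟩ := hD; exact S.whiskerLeft_comp
  id_whiskerLeft := by obtain ⟨S, rfl⟩ := hD; exact S.id_whiskerLeft
  comp_whiskerLeft := by obtain ⟨S, rfl⟩ := hD; exact S.comp_whiskerLeft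
  id_whiskerRight := by obtain ⟨S, rfl⟩ := hD; exact S.id_whiskerRight
  comp_whiskerRight := by obtain ⟨S, rfl⟩ := hD; exact S.comp_whiskerRight
  whiskerRight_id := by obtain ⟨S, rfl⟩ := hD; exact S.whiskerRight_id
  whiskerRight_comp := by obtain ⟨S, rfl⟩ := hD; exact S.whiskerRight_comp
  whisker_assoc := by obtain ⟨S, rfl⟩ := hD; exact S.whisker_assoc
  whisker_exchange := by obtain ⟨S, rfl⟩ := hD; exact S.whisker_exchange
  pentagon := by obtain ⟨S, rfl⟩ := hD; exact S.pentagon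
  triangle := by obtain ⟨S, rfl⟩ := hD; exact S.triangle

/-! ### The bicategory data of a Morita context -/

/-- The two objects of the bicategory of a Morita context. -/
inductive Obj : Type
  | zero
  | one

namespace MoritaContext

variable (C : MoritaContext.{w, v, u} k)

/-- The Hom-categories. -/
@[reducible]
def hom : Obj → Obj → FinLinCat.{w, v, u} k
  | .zero, .zero => C.A.toFinLinCat
  | .zero, .one => C.M.toFinLinCat
  | .one, .zero => C.N.toFinLinCat
  | .one, .one => C.B.toFinLinCat

/-- The identity 1-morphisms. -/
def homId : ∀ i, C.hom i i
  | .zero => 𝟙_ C.A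
  | .one => 𝟙_ C.B

/-- Horizontal composition: the tensor products, the actions and the mixed products. -/
def homComp : ∀ {i j l : Obj}, C.hom i j → C.hom j l → C.hom i l
  | .zero, .zero, .zero => fun (a : C.A) (a' : C.A) => (a ⊗ a' : C.A)
  | .zero, .zero, .one => fun (a : C.A) (m : C.M) => (a ⊙ₗ m : C.M)
  | .zero, .one, .zero => fun (m : C.M) (n : C.N) => C.P.obj m n
  | .zero, .one, .one => fun (m : C.M) (b : C.B) => (m ⊙ᵣ b : C.M)
  | .one, .zero, .zero => fun (n : C.N) (a : C.A) => (n ⊙ᵣ a : C.N)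
  | .one, .zero, .one => fun (n : C.N) (m : C.M) => C.Q.obj n m
  | .one, .one, .zero => fun (b : C.B) (n : C.N) => (b ⊙ₗ n : C.N)
  | .one, .one, .one => fun (b : C.B) (b' : C.B) => (b ⊗ b' : C.B)

/-- Horizontal composition of an object with a morphism. -/
def homWhiskerLeft : ∀ {i j l : Obj} (f : C.hom i j) {g h : C.hom j l},
    (g ⟶ h) → (C.homComp f g ⟶ C.homComp f h)
  | .zero, .zero, .zero => fun (a : C.A) {g h : C.A} (η : g ⟶ h) => a ◁ η
  | .zero, .zero, .one => fun (a : C.A) {g h : C.M} (η : g ⟶ h) => a ⊴ₗ η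
  | .zero, .one, .zero => fun (m : C.M) {g h : C.N} (η : g ⟶ h) => (C.P.functor.obj m).map η
  | .zero, .one, .one => fun (m : C.M) {g h : C.B} (η : g ⟶ h) => m ⊴ᵣ η
  | .one, .zero, .zero => fun (n : C.N) {g h : C.A} (η : g ⟶ h) => n ⊴ᵣ η
  | .one, .zero, .one => fun (n : C.N) {g h : C.M} (η : g ⟶ h) => (C.Q.functor.obj n).map η
  | .one, .one, .zero => fun (b : C.B) {g h : C.N} (η : g ⟶ h) => b ⊴ₗ η
  | .one, .one, .one => fun (b : C.B) {g h : C.B} (η : g ⟶ h) => b ◁ η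

/-- Horizontal composition of a morphism with an object. -/
def homWhiskerRight : ∀ {i j l : Obj} (f g : C.hom i j),
    (f ⟶ g) → ∀ h : C.hom j l, C.homComp f h ⟶ C.homComp g h
  | .zero, .zero, .zero => fun (f g : C.A) (η : f ⟶ g) (a : C.A) => η ▷ a
  | .zero, .zero, .one => fun (f g : C.A) (η : f ⟶ g) (m : C.M) => η ⊵ₗ m
  | .zero, .one, .zero => fun (f g : C.M) (η : f ⟶ g) (n : C.N) => (C.P.functor.map η).app n
  | .zero, .one, .one => fun (f g : C.M) (η : f ⟶ g) (b : C.B) => η ⊵ᵣ b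
  | .one, .zero, .zero => fun (f g : C.N) (η : f ⟶ g) (a : C.A) => η ⊵ᵣ a
  | .one, .zero, .one => fun (f g : C.N) (η : f ⟶ g) (m : C.M) => (C.Q.functor.map η).app m
  | .one, .one, .zero => fun (f g : C.B) (η : f ⟶ g) (n : C.N) => η ⊵ₗ n
  | .one, .one, .one => fun (f g : C.B) (η : f ⟶ g) (b : C.B) => η ▷ b

/-- The sixteen associativity constraints. -/
def homAssociator : ∀ {h i j l : Obj} (x : C.hom h i) (y : C.hom i j) (z : C.hom j l),
    C.homComp (C.homComp x y) z ≅ C.homComp x (C.homComp y z)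
  | .zero, .zero, .zero, .zero => fun (x : C.A) (y : C.A) (z : C.A) => α_ x y z
  | .zero, .zero, .zero, .one => fun (x : C.A) (y : C.A) (z : C.M) => αₗ x y z
  | .zero, .zero, .one, .zero => fun (x : C.A) (y : C.M) (z : C.N) => (C.P.leftIso x y z).symm
  | .zero, .zero, .one, .one => fun (x : C.A) (y : C.M) (z : C.B) => C.M.middle x y z
  | .zero, .one, .zero, .zero => fun (x : C.M) (y : C.N) (z : C.A) => C.P.rightIso x y z
  | .zero, .one, .zero, .one => fun (x : C.M) (y : C.N) (z : C.M) => (C.α.iso x y z).symm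
  | .zero, .one, .one, .zero => fun (x : C.M) (y : C.B) (z : C.N) => C.P.balancing x y z
  | .zero, .one, .one, .one => fun (x : C.M) (y : C.B) (z : C.B) => (αᵣ x y z).symm
  | .one, .zero, .zero, .zero => fun (x : C.N) (y : C.A) (z : C.A) => (αᵣ x y z).symm
  | .one, .zero, .zero, .one => fun (x : C.N) (y : C.A) (z : C.M) => C.Q.balancing x y z
  | .one, .zero, .one, .zero => fun (x : C.N) (y : C.M) (z : C.N) => (C.β.iso x y z).symm
  | .one, .zero, .one, .one => fun (x : C.N) (y : C.M) (z : C.B) => C.Q.rightIso x y z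
  | .one, .one, .zero, .zero => fun (x : C.B) (y : C.N) (z : C.A) => C.N.middle x y z
  | .one, .one, .zero, .one => fun (x : C.B) (y : C.N) (z : C.M) => (C.Q.leftIso x y z).symm
  | .one, .one, .one, .zero => fun (x : C.B) (y : C.B) (z : C.N) => αₗ x y z
  | .one, .one, .one, .one => fun (x : C.B) (y : C.B) (z : C.B) => α_ x y z

/-- The left unit constraints. -/
def homLeftUnitor : ∀ {i j : Obj} (f : C.hom i j), C.homComp (C.homId i) f ≅ f
  | .zero, .zero => fun (f : C.A) => λ_ f
  | .zero, .one => fun (f : C.M) => MonoidalLeftAction.actionUnitIso (C := C.A) f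
  | .one, .zero => fun (f : C.N) => MonoidalLeftAction.actionUnitIso (C := C.B) f
  | .one, .one => fun (f : C.B) => λ_ f

/-- The right unit constraints. -/
def homRightUnitor : ∀ {i j : Obj} (f : C.hom i j), C.homComp f (C.homId j) ≅ f
  | .zero, .zero => fun (f : C.A) => ρ_ f
  | .zero, .one => fun (f : C.M) => MonoidalRightAction.actionUnitIso (C := C.B) f
  | .one, .zero => fun (f : C.N) => MonoidalRightAction.actionUnitIso (C := C.A) f
  | .one, .one => fun (f : C.B) => ρ_ f

/-- The data of a two-object bicategory given by a Morita context. -/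
def bicategoryData : BicategoryData.{v, u} Obj where
  Hom i j := C.hom i j
  category i j := (C.hom i j).category
  id := C.homId
  comp := C.homComp
  whiskerLeft := C.homWhiskerLeft
  whiskerRight η h := C.homWhiskerRight _ _ η h
  associator := C.homAssociator
  leftUnitor := C.homLeftUnitor
  rightUnitor := C.homRightUnitor

end MoritaContext

/-! ### Pseudo-equivalences -/

section PseudoEquivalence

open Bicategory

/-- The 1-morphism `f` is an equivalence (is invertible up to invertible 2-morphisms). -/
def IsEquivalenceOneMorphism {O : Type} [Bicategory.{v, u} O] {x y : O} (f : x ⟶ y) : Prop :=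
  ∃ g : y ⟶ x, Nonempty (f ≫ g ≅ 𝟙 x) ∧ Nonempty (g ≫ f ≅ 𝟙 y)

/-- There is a pseudo-natural equivalence between the pseudo-functors `U` and `V`. -/
def PseudonaturallyEquivalent {O O' : Type} [Bicategory.{v, u} O] [Bicategory.{v, u} O']
    (U V : Pseudofunctor O O') : Prop :=
  ∃ η : Pseudofunctor.StrongTrans U V, ∀ x, IsEquivalenceOneMorphism (η.app x)

/-- The pseudo-functor `U` is `k`-linear on Hom-categories. -/
def IsLinearPseudofunctor (k : Type w) [Field k] {O O' : Type}
    [Bicategory.{v, u} O] [Bicategory.{v, u} O']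
    [∀ x y : O, Preadditive (x ⟶ y)] [∀ x y : O, Linear k (x ⟶ y)]
    [∀ x y : O', Preadditive (x ⟶ y)] [∀ x y : O', Linear k (x ⟶ y)]
    (U : Pseudofunctor O O') : Prop :=
  ∀ (x y : O) (f g : x ⟶ y) (η θ : f ⟶ g) (c : k),
    U.map₂ (η + θ) = U.map₂ η + U.map₂ θ ∧ U.map₂ (c • η) = c • U.map₂ η

/-- Two bicategories with `k`-linear Hom-categories are `k`-linearly pseudo-equivalent. -/
def PseudoEquivalent (k : Type w) [Field k] (O O' : Type)
    [Bicategory.{v, u} O] [Bicategory.{v, u} O']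
    [∀ x y : O, Preadditive (x ⟶ y)] [∀ x y : O, Linear k (x ⟶ y)]
    [∀ x y : O', Preadditive (x ⟶ y)] [∀ x y : O', Linear k (x ⟶ y)] : Prop :=
  ∃ (U : Pseudofunctor O O') (V : Pseudofunctor O' O),
    IsLinearPseudofunctor k U ∧ IsLinearPseudofunctor k V ∧
    PseudonaturallyEquivalent (U.comp V) (Pseudofunctor.id O) ∧
    PseudonaturallyEquivalent (V.comp U) (Pseudofunctor.id O')

end PseudoEquivalence

/-- The Morita contexts `C` and `C'` are equivalent: their data form bicategories, and these are
pseudo-equivalent. -/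
def MoritaContext.Equivalent (C C' : MoritaContext.{w, v, u} k) : Prop :=
  ∃ (hC : C.bicategoryData.IsBicategory) (hC' : C'.bicategoryData.IsBicategory),
    @PseudoEquivalent k _ Obj Obj hC.toBicategory hC'.toBicategory
      (fun i j => (C.hom i j).abelian.toPreadditive) (fun i j => (C.hom i j).linear)
      (fun i j => (C'.hom i j).abelian.toPreadditive) (fun i j => (C'.hom i j).linear)

end Morita

namespace Morita

variable {k : Type w} [Field k]

/-! Part (1) is a matching of axioms. Functoriality of whiskering and the interchange law are part
of bifunctoriality, and naturality of the associator is the naturality of the context's constraints.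
The pentagon has one instance for each sequence of five objects, 32 in all. After inverting those
constraints that point from x(yz) to (xy)z, each instance is one of the axioms of monoidal category,
module category, mixed product or mixed associator, or the pentagon between α and β. The one thing
that is not an axiom is the triangle for the balancings: `MixedProduct.balancing_triangle` derives
it from the balancing pentagon at two unit objects, as in the usual argument that some unit axioms
of a monoidal category are redundant.

Part (2) is the path strictification of a bicategory. Its 1-morphisms are formal composable paths,
and its 2-morphisms are the 2-morphisms between evaluated composites. Concatenation of paths is
strictly associative and unital, and coherence of the comparison `pathEvalComp` shows that the
constraint 2-isomorphisms really are identities (`pathEvalComp_assoc`, `pathEvalComp_nil`).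
Evaluation and the inclusion of one-step paths are mutually inverse up to pseudo-natural
equivalence.

To return to Morita contexts, `IsMoritaBicategory` isolates what must be known of a bicategory,
besides abelian linear Hom-categories and rigid endomorphism categories, for two distinct objects of
it to form a context. Evaluation is an equivalence on each Hom-category, compatible with
composition, so finiteness, linearity, exactness, rigidity and simplicity of the units all pass to
paths. The context read off from the path bicategory is strict because each of its constraints is an
associator, a unitor or the inverse of an associator. -/

@[simp]
lemma bimap_id_left {C D E : Type*} [Category* C] [Category* D] [Category* E] (F : C ⥤ D ⥤ E)
    (c : C) {d d' : D} (g : d ⟶ d') : bimap F (𝟙 c) g = (F.obj c).map g := by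
  simp [bimap]

@[simp]
lemma bimap_id_right {C D E : Type*} [Category* C] [Category* D] [Category* E] (F : C ⥤ D ⥤ E)
    {c c' : C} (f : c ⟶ c') (d : D) : bimap F f (𝟙 d) = (F.map f).app d := by
  simp [bimap]

lemma comp_inv_eq_inv_comp {C : Type*} [Category* C] {X X' Y Y' : C} {e : X ≅ Y} {e' : X' ≅ Y'}
    {f : X ⟶ X'} {g : Y ⟶ Y'} (h : f ≫ e'.hom = e.hom ≫ g) : g ≫ e'.inv = e.inv ≫ f := by
  rw [Iso.comp_inv_eq, Category.assoc, h, Iso.inv_hom_id_assoc]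

/-! ### The axioms of a context in the shape of the bicategory pentagon and triangle -/

section Pentagons

variable {A B : FinMultitensorCat.{w, v, u} k} {M : BimoduleCat A B} {N : BimoduleCat B A}
  {P : MixedProduct M N} {Q : MixedProduct N M}

namespace BimoduleCat

/-- The isomorphisms `αᵣ`, `leftIso` and the components of a `MixedAssociator` point from x(yz) to
(xy)z, against the associator of a bicategory. This lemma and most of those below move them to their
inverses, so that each axiom becomes an instance of one and the same pentagon. -/
lemma pentagon_right_inv (M : BimoduleCat A B) (a : A) (m : M) (b b' : B) :
    (M.middle a m b).hom ⊵ᵣ b' ≫ (M.middle a (m ⊙ᵣ b) b').hom ≫ a ⊴ₗ (αᵣ m b b').inv =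
      (αᵣ (a ⊙ₗ m) b b').inv ≫ (M.middle a m (b ⊗ b')).hom := by
  rw [← Category.assoc, M.pentagon_right]
  simp

end BimoduleCat

lemma rightAction_pentagon_inv (m : M) (b b' b'' : B) :
    (αᵣ m b b').inv ⊵ᵣ b'' ≫ (αᵣ m (b ⊗ b') b'').inv ≫ m ⊴ᵣ (α_ b b' b'').hom =
      (αᵣ (m ⊙ᵣ b) b' b'').inv ≫ (αᵣ m b (b' ⊗ b'')).inv := by
  rw [← cancel_mono ((αᵣ m b (b' ⊗ b'')).hom ≫ (αᵣ (m ⊙ᵣ b) b' b'').hom)]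
  simp only [Category.assoc, MonoidalRightAction.actionHom_associator]
  simp

lemma rightAction_triangle (m : M) (b : B) :
    (αᵣ m (𝟙_ B) b).inv ≫ m ⊴ᵣ (λ_ b).hom =
      (MonoidalRightAction.actionUnitIso (C := B) m).hom ⊵ᵣ b := by
  simp

namespace MixedProduct

lemma rightIso_balancing_symm (P : MixedProduct M N) (m : M) (b : B) (n : N) (a : A) :
    (P.balancing m b n).hom ▷ a ≫ (P.rightIso m (b ⊙ₗ n) a).hom ≫
        (P.functor.obj m).map (N.middle b n a).hom =
      (P.rightIso (m ⊙ᵣ b) n a).hom ≫ (P.balancing m b (n ⊙ᵣ a)).hom :=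
  (P.rightIso_balancing m b n a).symm

lemma leftIso_pentagon_inv (P : MixedProduct M N) (a a' : A) (m : M) (n : N) :
    (P.functor.map (αₗ a a' m).hom).app n ≫ (P.leftIso a (a' ⊙ₗ m) n).inv ≫
        a ◁ (P.leftIso a' m n).inv =
      (P.leftIso (a ⊗ a') m n).inv ≫ (α_ a a' (P.obj m n)).hom := by
  rw [← cancel_epi (P.leftIso (a ⊗ a') m n).hom, ← Category.assoc, P.leftIso_pentagon]
  simp

lemma bimodule_pentagon_inv (P : MixedProduct M N) (a : A) (m : M) (n : N) (a' : A) :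
    (P.leftIso a m n).inv ▷ a' ≫ (α_ a (P.obj m n) a').hom ≫ a ◁ (P.rightIso m n a').hom =
      (P.rightIso (a ⊙ₗ m) n a').hom ≫ (P.leftIso a m (n ⊙ᵣ a')).inv := by
  rw [Iso.eq_comp_inv, ← cancel_epi ((P.leftIso a m n).hom ▷ a'), P.bimodule_pentagon]
  simp

lemma leftIso_balancing_inv (P : MixedProduct M N) (a : A) (m : M) (b : B) (n : N) :
    (P.functor.map (M.middle a m b).hom).app n ≫ (P.leftIso a (m ⊙ᵣ b) n).inv ≫
        a ◁ (P.balancing m b n).hom =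
      (P.balancing (a ⊙ₗ m) b n).hom ≫ (P.leftIso a m (b ⊙ₗ n)).inv := by
  rw [← cancel_mono (P.leftIso a m (b ⊙ₗ n)).hom]
  simp only [Category.assoc, ← P.leftIso_balancing]
  simp [← NatTrans.comp_app_assoc, ← Functor.map_comp]

lemma rightIso_pentagon_inv (P : MixedProduct M N) (m : M) (n : N) (a a' : A) :
    (P.rightIso m n a).hom ▷ a' ≫ (P.rightIso m (n ⊙ᵣ a) a').hom ≫
        (P.functor.obj m).map (αᵣ n a a').inv =
      (α_ (P.obj m n) a a').hom ≫ (P.rightIso m n (a ⊗ a')).hom := by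
  rw [← cancel_mono ((P.functor.obj m).map (αᵣ n a a').hom), Category.assoc (α_ _ _ _).hom,
    P.rightIso_pentagon]
  simp [← Functor.map_comp]

lemma balancing_pentagon_inv (P : MixedProduct M N) (m : M) (b b' : B) (n : N) :
    (P.functor.map (αᵣ m b b').inv).app n ≫ (P.balancing m (b ⊗ b') n).hom ≫
        (P.functor.obj m).map (αₗ b b' n).hom =
      (P.balancing (m ⊙ᵣ b) b' n).hom ≫ (P.balancing m b (b' ⊙ₗ n)).hom := by
  rw [P.balancing_pentagon]
  simp [← NatTrans.comp_app_assoc, ← Functor.map_comp]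

/-- The unit axiom of a balancing follows from its pentagon axiom. -/
lemma balancing_triangle (P : MixedProduct M N) (m : M) (n : N) :
    (P.balancing m (𝟙_ B) n).hom ≫
        (P.functor.obj m).map (MonoidalLeftAction.actionUnitIso (C := B) n).hom =
      (P.functor.map (MonoidalRightAction.actionUnitIso (C := B) m).hom).app n := by
  let r := MonoidalRightAction.actionUnitIso (C := B) m
  let l := MonoidalLeftAction.actionUnitIso (C := B) n
  have hl : (P.balancing m (𝟙_ B) (𝟙_ B ⊙ₗ n)).hom ≫ (P.functor.obj m).map (𝟙_ B ⊴ₗ l.hom) =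
      (P.functor.obj (m ⊙ᵣ 𝟙_ B)).map l.hom ≫ (P.balancing m (𝟙_ B) n).hom := by
    simpa only [MonoidalRightAction.actionHom_id, MonoidalRightAction.id_actionHomLeft,
      bimap_id_left, MonoidalLeftAction.id_actionHom] using
      (P.balancing_naturality (𝟙 m) (𝟙 (𝟙_ B)) l.hom).symm
  have hb : (P.balancing m (𝟙_ B ⊗ 𝟙_ B) n).hom ≫
        (P.functor.obj m).map ((λ_ (𝟙_ B)).hom ⊵ₗ n) =
      (P.functor.map (m ⊴ᵣ (λ_ (𝟙_ B)).hom)).app n ≫ (P.balancing m (𝟙_ B) n).hom := by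
    simpa only [MonoidalRightAction.id_actionHom, MonoidalLeftAction.actionHom_id, bimap_id_left,
      bimap_id_right] using (P.balancing_naturality (𝟙 m) (λ_ (𝟙_ B)).hom (𝟙 n)).symm
  have hr : (P.functor.map (r.hom ⊵ᵣ 𝟙_ B)).app n ≫ (P.balancing m (𝟙_ B) n).hom =
      (P.balancing (m ⊙ᵣ 𝟙_ B) (𝟙_ B) n).hom ≫ (P.functor.map r.hom).app (𝟙_ B ⊙ₗ n) := by
    simpa only [MonoidalRightAction.actionHom_id, MonoidalLeftAction.id_actionHom,
      MonoidalLeftAction.actionHomRight_id, bimap_id_right] using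
      P.balancing_naturality r.hom (𝟙 (𝟙_ B)) (𝟙 n)
  -- The pentagon at two unit objects, followed by the unit constraint of `n`. Since `λ_` and `ρ_`
  -- agree at the unit, naturality gives both sides the common first factor `αᵣ` and the common last
  -- factor `P.balancing m (𝟙_ B) n`, and both cancel.
  have h := congr($(P.balancing_pentagon m (𝟙_ B) (𝟙_ B) n) ≫
    (P.functor.obj m).map (𝟙_ B ⊴ₗ l.hom))
  simp only [Category.assoc, ← Functor.map_comp, l,
    ← MonoidalLeftAction.rightUnitor_actionHom] at h
  rw [← unitors_equal, hb, MonoidalRightAction.actionHom_leftUnitor, hl, Functor.map_comp,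
    NatTrans.comp_app, Category.assoc, cancel_epi, ← Category.assoc (P.balancing _ _ _).hom,
    cancel_mono] at h
  -- Now `h` is in essence the triangle at `m ⊙ᵣ 𝟙_ B`; naturality along the isomorphism `r` brings
  -- it down to `m`.
  rw [← cancel_epi ((P.functor.map (r.hom ⊵ᵣ 𝟙_ B)).app n), ← Category.assoc, hr, Category.assoc,
    ← NatTrans.naturality, ← Category.assoc, ← h]

end MixedProduct

namespace MixedAssociator

lemma left_linear_inv (α : MixedAssociator P Q) (a : A) (m : M) (n : N) (m' : M) :
    (P.leftIso a m n).inv ⊵ₗ m' ≫ (αₗ a (P.obj m n) m').hom ≫ a ⊴ₗ (α.iso m n m').inv =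
      (α.iso (a ⊙ₗ m) n m').inv ≫ (M.middle a m (Q.obj n m')).hom := by
  rw [Iso.eq_inv_comp, α.left_linear]
  simp

lemma right_linear_inv (α : MixedAssociator P Q) (m : M) (n : N) (m' : M) (b : B) :
    (α.iso m n m').inv ⊵ᵣ b ≫ (αᵣ m (Q.obj n m') b).inv ≫ m ⊴ᵣ (Q.rightIso n m' b).hom =
      (M.middle (P.obj m n) m' b).hom ≫ (α.iso m n (m' ⊙ᵣ b)).inv := by
  rw [Iso.eq_comp_inv]
  simp only [Category.assoc, α.right_linear]
  simp

lemma balanced_left_inv (α : MixedAssociator P Q) (m : M) (b : B) (n : N) (m' : M) :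
    (P.balancing m b n).hom ⊵ₗ m' ≫ (α.iso m (b ⊙ₗ n) m').inv ≫
        m ⊴ᵣ (Q.leftIso b n m').inv =
      (α.iso (m ⊙ᵣ b) n m').inv ≫ (αᵣ m b (Q.obj n m')).inv := by
  rw [Iso.eq_inv_comp, ← Category.assoc, α.balanced_left]
  simp

lemma balanced_right_inv (α : MixedAssociator P Q) (m : M) (n : N) (a : A) (m' : M) :
    (P.rightIso m n a).hom ⊵ₗ m' ≫ (α.iso m (n ⊙ᵣ a) m').inv ≫
        m ⊴ᵣ (Q.balancing n a m').hom =
      (αₗ (P.obj m n) a m').hom ≫ (α.iso m n (a ⊙ₗ m')).inv := by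
  have h : (P.rightIso m n a).hom ⊵ₗ m' = (αₗ (P.obj m n) a m').hom ≫
      (α.iso m n (a ⊙ₗ m')).inv ≫ m ⊴ᵣ (Q.balancing n a m').inv ≫ (α.iso m (n ⊙ᵣ a) m').hom := by
    rw [α.balanced_right]
    simp
  rw [h]
  simp

end MixedAssociator

lemma MixedPentagon.inv {α : MixedAssociator P Q} {β : MixedAssociator Q P}
    (h : MixedPentagon α β) (m₁ : M) (n₁ : N) (m₂ : M) (n₂ : N) :
    (P.functor.map (α.iso m₁ n₁ m₂).inv).app n₂ ≫ (P.balancing m₁ (Q.obj n₁ m₂) n₂).hom ≫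
        (P.functor.obj m₁).map (β.iso n₁ m₂ n₂).inv =
      (P.leftIso (P.obj m₁ n₁) m₂ n₂).inv ≫ (P.rightIso m₁ n₁ (P.obj m₂ n₂)).hom := by
  rw [← h]
  simp [← NatTrans.comp_app_assoc, ← Functor.map_comp]

end Pentagons

variable {k : Type w} [Field k]

/-! ### The bicategory of a Morita context -/

namespace MoritaContext

variable (C : MoritaContext.{w, v, u} k)

lemma homWhiskerLeft_id : ∀ {i j l : Obj} (f : C.hom i j) (g : C.hom j l),
    C.homWhiskerLeft f (𝟙 g) = 𝟙 (C.homComp f g)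
  | .zero, .zero, .zero => MonoidalCategory.whiskerLeft_id
  | .zero, .zero, .one => MonoidalLeftAction.actionHomRight_id
  | .zero, .one, .zero => fun m n => (C.P.functor.obj m).map_id n
  | .zero, .one, .one => fun m b => MonoidalRightAction.actionHomRight_id b m
  | .one, .zero, .zero => fun m b => MonoidalRightAction.actionHomRight_id b m
  | .one, .zero, .one => fun m n => (C.Q.functor.obj m).map_id n
  | .one, .one, .zero => MonoidalLeftAction.actionHomRight_id
  | .one, .one, .one => MonoidalCategory.whiskerLeft_id

lemma homWhiskerLeft_comp : ∀ {i j l : Obj} (f : C.hom i j) {g g' g'' : C.hom j l}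
    (η : g ⟶ g') (θ : g' ⟶ g''),
    C.homWhiskerLeft f (η ≫ θ) = C.homWhiskerLeft f η ≫ C.homWhiskerLeft f θ
  | .zero, .zero, .zero => fun a _ _ _ => MonoidalCategory.whiskerLeft_comp a
  | .zero, .zero, .one => fun a _ _ _ => MonoidalLeftAction.actionHomRight_comp a
  | .zero, .one, .zero => fun m _ _ _ => (C.P.functor.obj m).map_comp
  | .zero, .one, .one => fun m _ _ _ => MonoidalRightAction.actionHomRight_comp m
  | .one, .zero, .zero => fun m _ _ _ => MonoidalRightAction.actionHomRight_comp m
  | .one, .zero, .one => fun m _ _ _ => (C.Q.functor.obj m).map_comp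
  | .one, .one, .zero => fun a _ _ _ => MonoidalLeftAction.actionHomRight_comp a
  | .one, .one, .one => fun a _ _ _ => MonoidalCategory.whiskerLeft_comp a

lemma homWhiskerRight_id : ∀ {i j l : Obj} (f : C.hom i j) (g : C.hom j l),
    C.homWhiskerRight f f (𝟙 f) g = 𝟙 (C.homComp f g)
  | .zero, .zero, .zero => MonoidalCategory.id_whiskerRight
  | .zero, .zero, .one => MonoidalLeftAction.id_actionHomLeft
  | .zero, .one, .zero => fun m n => congr($(C.P.functor.map_id m).app n)
  | .zero, .one, .one => fun m b => MonoidalRightAction.id_actionHomLeft b m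
  | .one, .zero, .zero => fun m b => MonoidalRightAction.id_actionHomLeft b m
  | .one, .zero, .one => fun m n => congr($(C.Q.functor.map_id m).app n)
  | .one, .one, .zero => MonoidalLeftAction.id_actionHomLeft
  | .one, .one, .one => MonoidalCategory.id_whiskerRight

lemma homWhiskerRight_comp : ∀ {i j l : Obj} {f f' f'' : C.hom i j}
    (η : f ⟶ f') (θ : f' ⟶ f'') (g : C.hom j l),
    C.homWhiskerRight f f'' (η ≫ θ) g = C.homWhiskerRight f f' η g ≫ C.homWhiskerRight f' f'' θ g
  | .zero, .zero, .zero => MonoidalCategory.comp_whiskerRight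
  | .zero, .zero, .one => MonoidalLeftAction.comp_actionHomLeft
  | .zero, .one, .zero => fun η θ n => congr($(C.P.functor.map_comp η θ).app n)
  | .zero, .one, .one => MonoidalRightAction.comp_actionHomLeft
  | .one, .zero, .zero => MonoidalRightAction.comp_actionHomLeft
  | .one, .zero, .one => fun η θ n => congr($(C.Q.functor.map_comp η θ).app n)
  | .one, .one, .zero => MonoidalLeftAction.comp_actionHomLeft
  | .one, .one, .one => MonoidalCategory.comp_whiskerRight

lemma homWhisker_exchange : ∀ {i j l : Obj} {f f' : C.hom i j} {g g' : C.hom j l}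
    (η : f ⟶ f') (θ : g ⟶ g'),
    C.homWhiskerLeft f θ ≫ C.homWhiskerRight f f' η g' =
      C.homWhiskerRight f f' η g ≫ C.homWhiskerLeft f' θ
  | .zero, .zero, .zero => MonoidalCategory.whisker_exchange
  | .zero, .zero, .one => MonoidalLeftAction.action_exchange
  | .zero, .one, .zero => fun η θ => (C.P.functor.map η).naturality θ
  | .zero, .one, .one => MonoidalRightAction.action_exchange
  | .one, .zero, .zero => MonoidalRightAction.action_exchange
  | .one, .zero, .one => fun η θ => (C.Q.functor.map η).naturality θ
  | .one, .one, .zero => MonoidalLeftAction.action_exchange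
  | .one, .one, .one => MonoidalCategory.whisker_exchange

lemma id_homWhiskerLeft : ∀ {i j : Obj} {f g : C.hom i j} (η : f ⟶ g),
    C.homWhiskerLeft (C.homId i) η =
      (C.homLeftUnitor f).hom ≫ η ≫ (C.homLeftUnitor g).inv
  | .zero, .zero => MonoidalCategory.id_whiskerLeft
  | .zero, .one => MonoidalLeftAction.unit_actionHomRight
  | .one, .zero => MonoidalLeftAction.unit_actionHomRight
  | .one, .one => MonoidalCategory.id_whiskerLeft

lemma homWhiskerRight_homId : ∀ {i j : Obj} {f g : C.hom i j} (η : f ⟶ g),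
    C.homWhiskerRight f g η (C.homId j) =
      (C.homRightUnitor f).hom ≫ η ≫ (C.homRightUnitor g).inv
  | .zero, .zero => MonoidalCategory.whiskerRight_id
  | .zero, .one => MonoidalRightAction.unit_actionHomRight
  | .one, .zero => MonoidalRightAction.unit_actionHomRight
  | .one, .one => MonoidalCategory.whiskerRight_id

/-- Horizontal composition of morphisms. -/
def homMap {i j l : Obj} {f f' : C.hom i j} {g g' : C.hom j l} (η : f ⟶ f') (θ : g ⟶ g') :
    C.homComp f g ⟶ C.homComp f' g' :=
  C.homWhiskerRight f f' η g ≫ C.homWhiskerLeft f' θ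

lemma homMap_id_left {i j l : Obj} (f : C.hom i j) {g g' : C.hom j l} (θ : g ⟶ g') :
    C.homMap (𝟙 f) θ = C.homWhiskerLeft f θ := by
  rw [homMap, homWhiskerRight_id, Category.id_comp]

lemma homMap_id_right {i j l : Obj} {f f' : C.hom i j} (η : f ⟶ f') (g : C.hom j l) :
    C.homMap η (𝟙 g) = C.homWhiskerRight f f' η g := by
  rw [homMap, homWhiskerLeft_id, Category.comp_id]

/-- Joint naturality in three variables is the form in which the context supplies it. Putting
identities in two of the three slots yields the bicategory axioms `comp_whiskerLeft`,
`whisker_assoc` and `whiskerRight_comp`. -/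
lemma homAssociator_naturality : ∀ {h i j l : Obj} {x x' : C.hom h i} {y y' : C.hom i j}
    {z z' : C.hom j l} (η : x ⟶ x') (θ : y ⟶ y') (ζ : z ⟶ z'),
    C.homMap (C.homMap η θ) ζ ≫ (C.homAssociator x' y' z').hom =
      (C.homAssociator x y z).hom ≫ C.homMap η (C.homMap θ ζ)
  | .zero, .zero, .zero, .zero => fun η θ ζ => by
    have h := associator_naturality η θ ζ
    simp only [MonoidalCategory.tensorHom_def] at h
    exact h
  | .zero, .zero, .zero, .one => fun η θ ζ => by
    have h := MonoidalLeftAction.actionAssocIso_hom_naturality η θ ζ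
    simp only [MonoidalCategory.tensorHom_def, MonoidalLeftAction.actionHom_def] at h
    exact h
  | .zero, .zero, .one, .zero => fun η θ ζ => by
    have h := comp_inv_eq_inv_comp (C.P.leftIso_naturality η θ ζ)
    simp only [MonoidalCategory.tensorHom_def, MonoidalLeftAction.actionHom_def] at h
    exact h
  | .zero, .zero, .one, .one => fun η θ ζ => by
    have h := C.M.middle_naturality η θ ζ
    simp only [MonoidalRightAction.actionHom_def, MonoidalLeftAction.actionHom_def] at h
    exact h
  | .zero, .one, .zero, .zero => fun η θ ζ => by
    have h := C.P.rightIso_naturality η θ ζ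
    simp only [MonoidalCategory.tensorHom_def, MonoidalRightAction.actionHom_def] at h
    exact h
  | .zero, .one, .zero, .one => fun η θ ζ => by
    have h := comp_inv_eq_inv_comp (C.α.naturality η θ ζ)
    simp only [MonoidalRightAction.actionHom_def, MonoidalLeftAction.actionHom_def] at h
    exact h
  | .zero, .one, .one, .zero => fun η θ ζ => by
    have h := C.P.balancing_naturality η θ ζ
    simp only [MonoidalRightAction.actionHom_def, MonoidalLeftAction.actionHom_def] at h
    exact h
  | .zero, .one, .one, .one => fun η θ ζ => by
    have h := MonoidalRightAction.actionAssocIso_inv_naturality η θ ζ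
    simp only [MonoidalCategory.tensorHom_def, MonoidalRightAction.actionHom_def] at h
    exact h
  | .one, .zero, .zero, .zero => fun η θ ζ => by
    have h := MonoidalRightAction.actionAssocIso_inv_naturality η θ ζ
    simp only [MonoidalCategory.tensorHom_def, MonoidalRightAction.actionHom_def] at h
    exact h
  | .one, .zero, .zero, .one => fun η θ ζ => by
    have h := C.Q.balancing_naturality η θ ζ
    simp only [MonoidalRightAction.actionHom_def, MonoidalLeftAction.actionHom_def] at h
    exact h
  | .one, .zero, .one, .zero => fun η θ ζ => by
    have h := comp_inv_eq_inv_comp (C.β.naturality η θ ζ)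
    simp only [MonoidalRightAction.actionHom_def, MonoidalLeftAction.actionHom_def] at h
    exact h
  | .one, .zero, .one, .one => fun η θ ζ => by
    have h := C.Q.rightIso_naturality η θ ζ
    simp only [MonoidalCategory.tensorHom_def, MonoidalRightAction.actionHom_def] at h
    exact h
  | .one, .one, .zero, .zero => fun η θ ζ => by
    have h := C.N.middle_naturality η θ ζ
    simp only [MonoidalRightAction.actionHom_def, MonoidalLeftAction.actionHom_def] at h
    exact h
  | .one, .one, .zero, .one => fun η θ ζ => by
    have h := comp_inv_eq_inv_comp (C.Q.leftIso_naturality η θ ζ)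
    simp only [MonoidalCategory.tensorHom_def, MonoidalLeftAction.actionHom_def] at h
    exact h
  | .one, .one, .one, .zero => fun η θ ζ => by
    have h := MonoidalLeftAction.actionAssocIso_hom_naturality η θ ζ
    simp only [MonoidalCategory.tensorHom_def, MonoidalLeftAction.actionHom_def] at h
    exact h
  | .one, .one, .one, .one => fun η θ ζ => by
    have h := associator_naturality η θ ζ
    simp only [MonoidalCategory.tensorHom_def] at h
    exact h

/-- The second sixteen cases are the first sixteen with the two objects exchanged. Only the two
alternating sequences involve α and β together, and they are the two mixed pentagons of the context.
-/
lemma hom_pentagon : ∀ {g h i j l : Obj} (x : C.hom g h) (y : C.hom h i) (z : C.hom i j)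
    (t : C.hom j l),
    C.homWhiskerRight _ _ (C.homAssociator x y z).hom t ≫
        (C.homAssociator x (C.homComp y z) t).hom ≫
          C.homWhiskerLeft x (C.homAssociator y z t).hom =
      (C.homAssociator (C.homComp x y) z t).hom ≫ (C.homAssociator x y (C.homComp z t)).hom
  | .zero, .zero, .zero, .zero, .zero => MonoidalCategory.pentagon
  | .zero, .zero, .zero, .zero, .one => MonoidalLeftAction.associator_actionHom
  | .zero, .zero, .zero, .one, .zero => C.P.leftIso_pentagon_inv
  | .zero, .zero, .zero, .one, .one => C.M.pentagon_left
  | .zero, .zero, .one, .zero, .zero => C.P.bimodule_pentagon_inv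
  | .zero, .zero, .one, .zero, .one => C.α.left_linear_inv
  | .zero, .zero, .one, .one, .zero => C.P.leftIso_balancing_inv
  | .zero, .zero, .one, .one, .one => C.M.pentagon_right_inv
  | .zero, .one, .zero, .zero, .zero => C.P.rightIso_pentagon_inv
  | .zero, .one, .zero, .zero, .one => C.α.balanced_right_inv
  | .zero, .one, .zero, .one, .zero => MixedPentagon.inv C.pentagon
  | .zero, .one, .zero, .one, .one => C.α.right_linear_inv
  | .zero, .one, .one, .zero, .zero => C.P.rightIso_balancing_symm
  | .zero, .one, .one, .zero, .one => C.α.balanced_left_inv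
  | .zero, .one, .one, .one, .zero => C.P.balancing_pentagon_inv
  | .zero, .one, .one, .one, .one => rightAction_pentagon_inv
  | .one, .one, .one, .one, .one => MonoidalCategory.pentagon
  | .one, .one, .one, .one, .zero => MonoidalLeftAction.associator_actionHom
  | .one, .one, .one, .zero, .one => C.Q.leftIso_pentagon_inv
  | .one, .one, .one, .zero, .zero => C.N.pentagon_left
  | .one, .one, .zero, .one, .one => C.Q.bimodule_pentagon_inv
  | .one, .one, .zero, .one, .zero => C.β.left_linear_inv
  | .one, .one, .zero, .zero, .one => C.Q.leftIso_balancing_inv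
  | .one, .one, .zero, .zero, .zero => C.N.pentagon_right_inv
  | .one, .zero, .one, .one, .one => C.Q.rightIso_pentagon_inv
  | .one, .zero, .one, .one, .zero => C.β.balanced_right_inv
  | .one, .zero, .one, .zero, .one => MixedPentagon.inv C.pentagon'
  | .one, .zero, .one, .zero, .zero => C.β.right_linear_inv
  | .one, .zero, .zero, .one, .one => C.Q.rightIso_balancing_symm
  | .one, .zero, .zero, .one, .zero => C.β.balanced_left_inv
  | .one, .zero, .zero, .zero, .one => C.Q.balancing_pentagon_inv
  | .one, .zero, .zero, .zero, .zero => rightAction_pentagon_inv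

/-- Six cases are unit axioms of the tensor products and the actions. The two cases in which a unit
sits between the arguments of a mixed product are not axioms and come from `balancing_triangle`. -/
lemma hom_triangle : ∀ {i j l : Obj} (f : C.hom i j) (g : C.hom j l),
    (C.homAssociator f (C.homId j) g).hom ≫ C.homWhiskerLeft f (C.homLeftUnitor g).hom =
      C.homWhiskerRight _ _ (C.homRightUnitor f).hom g
  | .zero, .zero, .zero => MonoidalCategory.triangle
  | .zero, .zero, .one => fun a m => (MonoidalLeftAction.rightUnitor_actionHom a m).symm
  | .zero, .one, .zero => C.P.balancing_triangle
  | .zero, .one, .one => rightAction_triangle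
  | .one, .zero, .zero => rightAction_triangle
  | .one, .zero, .one => C.Q.balancing_triangle
  | .one, .one, .zero => fun a m => (MonoidalLeftAction.rightUnitor_actionHom a m).symm
  | .one, .one, .one => MonoidalCategory.triangle

/-- The bicategory of a Morita context. -/
@[reducible]
def bicategory : Bicategory.{v, u} Obj where
  Hom i j := C.hom i j
  id := C.homId
  comp := C.homComp
  homCategory i j := (C.hom i j).category
  whiskerLeft f _ _ η := C.homWhiskerLeft f η
  whiskerRight η h := C.homWhiskerRight _ _ η h
  associator := C.homAssociator
  leftUnitor := C.homLeftUnitor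
  rightUnitor := C.homRightUnitor
  whiskerLeft_id := C.homWhiskerLeft_id
  whiskerLeft_comp := C.homWhiskerLeft_comp
  id_whiskerLeft := C.id_homWhiskerLeft
  comp_whiskerLeft f g h h' η := by
    rw [← Category.assoc, Iso.eq_comp_inv]
    simpa only [homMap_id_left, homMap_id_right, homWhiskerRight_id] using
      C.homAssociator_naturality (𝟙 f) (𝟙 g) η
  id_whiskerRight := C.homWhiskerRight_id
  comp_whiskerRight := C.homWhiskerRight_comp
  whiskerRight_id := C.homWhiskerRight_homId
  whiskerRight_comp η g h := by
    rw [Iso.eq_inv_comp]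
    simpa only [homMap_id_left, homMap_id_right, homWhiskerRight_id] using
      (C.homAssociator_naturality η (𝟙 g) (𝟙 h)).symm
  whisker_assoc f g g' η h := by
    rw [← Category.assoc, Iso.eq_comp_inv]
    simpa only [homMap_id_left, homMap_id_right] using C.homAssociator_naturality (𝟙 f) η (𝟙 h)
  whisker_exchange := C.homWhisker_exchange
  pentagon := C.hom_pentagon
  triangle := C.hom_triangle

lemma ofBicategory_bicategory : BicategoryData.ofBicategory C.bicategory = C.bicategoryData :=
  rfl

end MoritaContext

/-! ### The path strictification of a bicategory -/

section Strictification

open Bicategory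

universe u₀

variable {O : Type u₀} [Bicategory.{v, u} O]

/-- The composite of a path of 1-morphisms. -/
def pathEval {a : O} : ∀ {b : O}, Quiver.Path a b → (a ⟶ b)
  | _, .nil => 𝟙 a
  -- Composites are bracketed to the left and start with an identity, so the empty path evaluates to
  -- `𝟙 a` on the nose, whereas a one-step path gives `𝟙 a ≫ f`, which is only isomorphic to `f`.
  | _, .cons p f => pathEval p ≫ f

/-- The composite of a concatenation is the composite of the composites. -/
def pathEvalComp {a b : O} (p : Quiver.Path a b) :
    ∀ {c : O} (q : Quiver.Path b c), pathEval (p.comp q) ≅ pathEval p ≫ pathEval q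
  | _, .nil => (Bicategory.rightUnitor (pathEval p)).symm
  | _, .cons q f =>
      whiskerRightIso (pathEvalComp p q) f ≪≫ Bicategory.associator (pathEval p) (pathEval q) f

/-- The 2-morphisms between paths are the 2-morphisms between their composites. -/
structure PathHom {a b : O} (p q : Quiver.Path a b) where
  /-- The underlying 2-morphism. -/
  hom : pathEval p ⟶ pathEval q

variable (O) in
/-- The objects of a bicategory, with paths of 1-morphisms as 1-morphisms. -/
def Strictification := O

namespace Strictification

/-- The underlying object. -/
def as (a : Strictification O) : O := a

instance : CategoryStruct (Strictification O) where
  Hom a b := Quiver.Path a.as b.as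
  id _ := .nil
  comp p q := Quiver.Path.comp p q

/-- The composite of a 1-morphism of the strictification. -/
def eval {a b : Strictification O} (p : a ⟶ b) : a.as ⟶ b.as := pathEval p

/-- `eval` is compatible with composition. -/
def evalComp {a b c : Strictification O} (p : a ⟶ b) (q : b ⟶ c) :
    eval (p ≫ q) ≅ eval p ≫ eval q :=
  pathEvalComp p q

/-- `eval` is compatible with identities. -/
def evalId (a : Strictification O) : eval (𝟙 a) ≅ 𝟙 a.as := Iso.refl _

instance (a b : Strictification O) : Category (a ⟶ b) where
  Hom p q := PathHom p q
  id p := ⟨𝟙 (eval p)⟩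
  comp f g := ⟨f.hom ≫ g.hom⟩
  id_comp f := congr(PathHom.mk $(Category.id_comp f.hom))
  comp_id f := congr(PathHom.mk $(Category.comp_id f.hom))
  assoc f g h := congr(PathHom.mk $(Category.assoc f.hom g.hom h.hom))

/-- The 2-morphism underlying a 2-morphism of the strictification. -/
def hom {a b : Strictification O} {p q : a ⟶ b} (f : p ⟶ q) : eval p ⟶ eval q := PathHom.hom f

/-- The 2-morphism of the strictification given by a 2-morphism. -/
def homMk {a b : Strictification O} {p q : a ⟶ b} (f : eval p ⟶ eval q) : p ⟶ q := PathHom.mk f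

variable {a b c d : Strictification O}

@[ext]
lemma hom_ext {p q : a ⟶ b} {f g : p ⟶ q} (h : hom f = hom g) : f = g :=
  congr(PathHom.mk $h)

@[simp]
lemma hom_homMk {p q : a ⟶ b} (f : eval p ⟶ eval q) : hom (homMk f : p ⟶ q) = f := rfl

@[simp]
lemma hom_id (p : a ⟶ b) : hom (𝟙 p) = 𝟙 (eval p) := rfl

@[simp]
lemma hom_comp {p q r : a ⟶ b} (f : p ⟶ q) (g : q ⟶ r) : hom (f ≫ g) = hom f ≫ hom g := rfl

/-- The 2-isomorphism of the strictification given by a 2-isomorphism. -/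
@[simps]
def isoMk {p q : a ⟶ b} (e : eval p ≅ eval q) : p ≅ q where
  hom := homMk e.hom
  inv := homMk e.inv

/-- All operations and constraints are those of `O` conjugated by `evalComp` and `evalId`, the only
choice that makes evaluation a pseudofunctor with these comparisons. In each axiom the comparisons
cancel and the axiom of `O` remains; where a comparison stands on the far side of another
2-morphism, the interchange law is needed first. -/
instance : Bicategory (Strictification O) where
  homCategory := inferInstance
  whiskerLeft p q r f := homMk ((evalComp p q).hom ≫ eval p ◁ hom f ≫ (evalComp p r).inv)
  whiskerRight {_ _ _ q r} f p :=
    homMk ((evalComp q p).hom ≫ hom f ▷ eval p ≫ (evalComp r p).inv)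
  associator p q r := isoMk (evalComp (p ≫ q) r ≪≫ whiskerRightIso (evalComp p q) (eval r) ≪≫
    Bicategory.associator (eval p) (eval q) (eval r) ≪≫
      whiskerLeftIso (eval p) (evalComp q r).symm ≪≫
      (evalComp p (q ≫ r)).symm)
  leftUnitor p := isoMk (evalComp (𝟙 _) p ≪≫ whiskerRightIso (evalId _) (eval p) ≪≫
    Bicategory.leftUnitor (eval p))
  rightUnitor p := isoMk (evalComp p (𝟙 _) ≪≫ whiskerLeftIso (eval p) (evalId _) ≪≫
    Bicategory.rightUnitor (eval p))
  whiskerLeft_id _ _ := by ext; simp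
  whiskerLeft_comp _ _ _ _ _ _ := by ext; simp
  id_whiskerLeft {a _ _ _} f := by
    have h := Bicategory.whisker_exchange (evalId a).hom (hom f)
    simp only [Bicategory.id_whiskerLeft] at h
    ext
    simp [← reassoc_of% h]
  comp_whiskerLeft p q _ _ f := by
    have h := Bicategory.whisker_exchange (evalComp p q).hom (hom f)
    simp only [Bicategory.comp_whiskerLeft] at h
    ext
    simp [← reassoc_of% h]
  id_whiskerRight _ _ := by ext; simp
  comp_whiskerRight _ _ _ := by ext; simp
  whiskerRight_id {_ b _ _} f := by
    have h := Bicategory.whisker_exchange (hom f) (evalId b).hom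
    simp only [Bicategory.whiskerRight_id] at h
    ext
    simp [reassoc_of% h]
  whiskerRight_comp f p q := by
    have h := Bicategory.whisker_exchange (hom f) (evalComp p q).hom
    simp only [Bicategory.whiskerRight_comp] at h
    ext
    simp [reassoc_of% h]
  whisker_assoc _ _ _ _ _ := by ext; simp
  whisker_exchange f g := by
    have h := Bicategory.whisker_exchange (hom f) (hom g)
    ext
    simp [reassoc_of% h]
  pentagon p q r s := by
    have h := Bicategory.whisker_exchange (evalComp p q).hom (evalComp r s).inv
    simp only [Bicategory.comp_whiskerLeft] at h
    ext
    simp [reassoc_of% h]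
  triangle _ _ := by ext; simp

end Strictification

end Strictification

/-! ### Strictness of the path bicategory and its equivalence with the original -/

section StrictificationEquivalence

open Bicategory

universe u₀

variable {O : Type u₀} [Bicategory.{v, u} O]

/-- The left side is the associator of the path bicategory, so this is what makes that associator an
identity. Induction on the last path: `pathEvalComp` unfolds along it, and the step for `cons r f`
is the previous case whiskered with `f`, up to pentagons in `O`. -/
lemma pathEvalComp_assoc {a b c : O} (p : Quiver.Path a b) (q : Quiver.Path b c) :
    ∀ {d : O} (r : Quiver.Path c d),
      (pathEvalComp (p.comp q) r).hom ≫ (pathEvalComp p q).hom ▷ pathEval r ≫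
        (Bicategory.associator (pathEval p) (pathEval q) (pathEval r)).hom ≫
          pathEval p ◁ (pathEvalComp q r).inv ≫ (pathEvalComp p (q.comp r)).inv =
        eqToHom (congrArg pathEval (Quiver.Path.comp_assoc p q r))
  | _, .nil => by
    simp [pathEvalComp, pathEval]
    rfl
  | _, .cons r f => by
    have h := congr($(pathEvalComp_assoc p q r) ▷ f)
    rw [Bicategory.eqToHom_whiskerRight] at h
    refine Eq.trans ?_ h
    simp [pathEvalComp, pathEval]

lemma pathEvalComp_nil {a : O} : ∀ {b : O} (p : Quiver.Path a b),
    (pathEvalComp .nil p).hom ≫ (Bicategory.leftUnitor (pathEval p)).hom =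
      eqToHom (congrArg pathEval (Quiver.Path.nil_comp p))
  | _, .nil => by
    simp [pathEvalComp, pathEval, Bicategory.unitors_equal]
    rfl
  | _, .cons p f => by
    have h := congr($(pathEvalComp_nil p) ▷ f)
    rw [Bicategory.eqToHom_whiskerRight] at h
    refine Eq.trans ?_ h
    simp [pathEvalComp, pathEval]
    rfl

namespace Strictification

variable {a b c d : Strictification O}

lemma hom_eqToHom {p q : a ⟶ b} (h : p = q) :
    hom (eqToHom h) = eqToHom (congrArg eval h) := by
  subst h
  rfl

lemma isIdentity_associator (p : a ⟶ b) (q : b ⟶ c) (r : c ⟶ d) :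
    IsIdentity (Bicategory.associator p q r) := by
  refine ⟨Quiver.Path.comp_assoc p q r, Iso.ext (hom_ext ?_)⟩
  rw [eqToIso.hom, hom_eqToHom]
  refine Eq.trans ?_ (pathEvalComp_assoc p q r)
  rfl

lemma isIdentity_leftUnitor (p : a ⟶ b) : IsIdentity (Bicategory.leftUnitor p) := by
  refine ⟨Quiver.Path.nil_comp p, Iso.ext (hom_ext ?_)⟩
  rw [eqToIso.hom, hom_eqToHom]
  refine Eq.trans ?_ (pathEvalComp_nil p)
  have h : 𝟙 (𝟙 a.as) ▷ eval p ≫ (Bicategory.leftUnitor (eval p)).hom =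
      (Bicategory.leftUnitor (eval p)).hom := by simp
  exact congr((evalComp (𝟙 a) p).hom ≫ $h)

lemma isIdentity_rightUnitor (p : a ⟶ b) : IsIdentity (Bicategory.rightUnitor p) := by
  -- Concatenation recurses on its second argument, so appending the empty path changes nothing
  -- definitionally; on the left an induction was required.
  refine ⟨rfl, Iso.ext (hom_ext ?_)⟩
  change (Bicategory.rightUnitor (eval p)).inv ≫ eval p ◁ 𝟙 (𝟙 b.as) ≫
    (Bicategory.rightUnitor (eval p)).hom = 𝟙 _
  rw [Bicategory.whiskerLeft_id, Category.id_comp, Iso.inv_hom_id]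

@[simp]
lemma hom_whiskerLeft (p : a ⟶ b) {q r : b ⟶ c} (f : q ⟶ r) :
    hom (p ◁ f) = (evalComp p q).hom ≫ eval p ◁ hom f ≫ (evalComp p r).inv := rfl

@[simp]
lemma hom_whiskerRight {q r : a ⟶ b} (f : q ⟶ r) (p : b ⟶ c) :
    hom (f ▷ p) = (evalComp q p).hom ≫ hom f ▷ eval p ≫ (evalComp r p).inv := rfl

@[simp]
lemma hom_associator_hom (p : a ⟶ b) (q : b ⟶ c) (r : c ⟶ d) :
    hom (Bicategory.associator p q r).hom = (evalComp (p ≫ q) r).hom ≫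
      (evalComp p q).hom ▷ eval r ≫ (Bicategory.associator (eval p) (eval q) (eval r)).hom ≫
        eval p ◁ (evalComp q r).inv ≫ (evalComp p (q ≫ r)).inv := rfl

@[simp]
lemma hom_leftUnitor_hom (p : a ⟶ b) : hom (Bicategory.leftUnitor p).hom =
    (evalComp (𝟙 a) p).hom ≫ (evalId a).hom ▷ eval p ≫ (Bicategory.leftUnitor (eval p)).hom := rfl

@[simp]
lemma hom_rightUnitor_hom (p : a ⟶ b) : hom (Bicategory.rightUnitor p).hom =
    (evalComp p (𝟙 b)).hom ≫ eval p ◁ (evalId b).hom ≫ (Bicategory.rightUnitor (eval p)).hom := rfl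

variable (O) in
/-- Composition of paths as a pseudofunctor. -/
@[simps]
def evalPseudofunctor : Pseudofunctor (Strictification O) O where
  obj a := a.as
  map p := eval p
  map₂ f := hom f
  mapId a := evalId a
  mapComp p q := evalComp p q

/-- The path consisting of one 1-morphism. -/
def single {a b : Strictification O} (f : a.as ⟶ b.as) : a ⟶ b :=
  Quiver.Path.cons Quiver.Path.nil f

/-- The composite of a path consisting of one 1-morphism. -/
def evalSingle {a b : Strictification O} (f : a.as ⟶ b.as) : eval (single f : a ⟶ b) ≅ f :=
  Bicategory.leftUnitor f

/-- The 2-morphism between one-step paths given by a 2-morphism. -/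
def singleMap {f g : a.as ⟶ b.as} (η : f ⟶ g) : (single f : a ⟶ b) ⟶ single g :=
  homMk ((evalSingle f).hom ≫ η ≫ (evalSingle g).inv)

/-- `single` is compatible with identities. -/
def singleId (a : Strictification O) : (single (𝟙 a.as) : a ⟶ a) ≅ 𝟙 a :=
  isoMk (evalSingle (𝟙 a.as) ≪≫ (evalId a).symm)

/-- `single` is compatible with composition. -/
def singleComp (f : a.as ⟶ b.as) (g : b.as ⟶ c.as) :
    (single (f ≫ g) : a ⟶ c) ≅ (single f : a ⟶ b) ≫ (single g : b ⟶ c) :=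
  isoMk (evalSingle (f ≫ g) ≪≫ whiskerRightIso (evalSingle f).symm g ≪≫
    whiskerLeftIso _ (evalSingle g).symm ≪≫ (evalComp (single f) (single g)).symm)

lemma singleMap_id (f : a.as ⟶ b.as) : singleMap (𝟙 f) = 𝟙 (single f : a ⟶ b) := by
  ext; simp [singleMap]

lemma singleMap_comp {f g h : a.as ⟶ b.as} (η : f ⟶ g) (θ : g ⟶ h) :
    (singleMap (η ≫ θ) : (single f : a ⟶ b) ⟶ _) = singleMap η ≫ singleMap θ := by
  ext; simp [singleMap]

lemma singleMap_whiskerLeft (f : a.as ⟶ b.as) {g h : b.as ⟶ c.as} (η : g ⟶ h) :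
    (singleMap (f ◁ η) : (single (f ≫ g) : a ⟶ c) ⟶ single (f ≫ h)) =
      (singleComp f g).hom ≫ (single f : a ⟶ b) ◁ (singleMap η : (single g : b ⟶ c) ⟶ _) ≫
        (singleComp f h).inv := by
  ext; simp [singleMap, singleComp, Bicategory.whisker_exchange_assoc]

lemma singleMap_whiskerRight {f g : a.as ⟶ b.as} (η : f ⟶ g) (h : b.as ⟶ c.as) :
    (singleMap (η ▷ h) : (single (f ≫ h) : a ⟶ c) ⟶ single (g ≫ h)) =
      (singleComp f h).hom ≫ (singleMap η : (single f : a ⟶ b) ⟶ _) ▷ (single h : b ⟶ c) ≫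
        (singleComp g h).inv := by
  ext; simp [singleMap, singleComp, Bicategory.whisker_exchange_assoc]

lemma singleMap_associator (f : a.as ⟶ b.as) (g : b.as ⟶ c.as) (h : c.as ⟶ d.as) :
    (singleMap (Bicategory.associator f g h).hom : (single ((f ≫ g) ≫ h) : a ⟶ d) ⟶ _) =
      (singleComp (f ≫ g) h).hom ≫ (singleComp f g).hom ▷ single h ≫
        (Bicategory.associator (single f : a ⟶ b) (single g : b ⟶ c) (single h : c ⟶ d)).hom ≫
          single f ◁ (singleComp g h).inv ≫ (singleComp f (g ≫ h)).inv := by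
  -- The two bracketings insert the unit corrections for `f` and `h` in opposite orders; interchange
  -- reconciles them.
  have e := Bicategory.whisker_exchange (evalSingle (a := a) (b := b) f).inv
    (g ◁ (evalSingle (a := c) (b := d) h).hom)
  simp only [Bicategory.whiskerRight_comp, Category.assoc] at e
  ext; simp [← reassoc_of% e, singleMap, singleComp, Bicategory.whisker_exchange_assoc]

lemma singleMap_leftUnitor (f : a.as ⟶ b.as) :
    (singleMap (Bicategory.leftUnitor f).hom : (single (𝟙 a.as ≫ f) : a ⟶ b) ⟶ _) =
      (singleComp (𝟙 a.as) f).hom ≫ (singleId a).hom ▷ (single f : a ⟶ b) ≫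
        (Bicategory.leftUnitor (single f : a ⟶ b)).hom := by
  ext; simp [singleMap, singleComp, singleId, Bicategory.whisker_exchange_assoc]

lemma singleMap_rightUnitor (f : a.as ⟶ b.as) :
    (singleMap (Bicategory.rightUnitor f).hom : (single (f ≫ 𝟙 b.as) : a ⟶ b) ⟶ _) =
      (singleComp f (𝟙 b.as)).hom ≫ (single f : a ⟶ b) ◁ (singleId b).hom ≫
        (Bicategory.rightUnitor (single f : a ⟶ b)).hom := by
  ext; simp [singleMap, singleComp, singleId]

variable (O) in
/-- The inclusion of a bicategory into its strictification. -/
def singlePseudofunctor : Pseudofunctor O (Strictification O) where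
  obj a := a
  map f := single f
  map₂ η := singleMap η
  mapId a := singleId a
  mapComp f g := singleComp f g
  map₂_id f := singleMap_id f
  map₂_comp η θ := singleMap_comp η θ
  map₂_whisker_left f _ _ η := singleMap_whiskerLeft f η
  map₂_whisker_right η h := singleMap_whiskerRight η h
  map₂_associator f g h := singleMap_associator f g h
  map₂_left_unitor f := singleMap_leftUnitor f
  map₂_right_unitor f := singleMap_rightUnitor f

lemma singleMap_hom_naturality {p q : a ⟶ b} (f : p ⟶ q) :
    singleMap (hom f) ≫ (isoMk (evalSingle (eval q)) : single (eval q) ≅ q).hom =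
      (isoMk (evalSingle (eval p)) : single (eval p) ≅ p).hom ≫ f := by
  ext; simp [singleMap]

lemma isoMk_evalSingle_id (a : Strictification O) :
    (isoMk (evalSingle (eval (𝟙 a))) : single (eval (𝟙 a)) ≅ 𝟙 a).hom =
      singleMap (evalId a).hom ≫ (singleId a).hom := by
  ext; simp [singleMap, singleId]

lemma isoMk_evalSingle_comp (p : a ⟶ b) (q : b ⟶ c) :
    (isoMk (evalSingle (eval (p ≫ q))) : single (eval (p ≫ q)) ≅ p ≫ q).hom =
      (singleMap (evalComp p q).hom ≫ (singleComp (eval p) (eval q)).hom) ≫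
        single (eval p) ◁ (isoMk (evalSingle (eval q)) : single (eval q) ≅ q).hom ≫
          (isoMk (evalSingle (eval p)) : single (eval p) ≅ p).hom ▷ q := by
  ext; simp [singleMap, singleComp]

lemma evalSingle_naturality {f g : a.as ⟶ b.as} (η : f ⟶ g) :
    hom (singleMap η : (single f : a ⟶ b) ⟶ _) ≫ (evalSingle g).hom = (evalSingle f).hom ≫ η := by
  simp [singleMap]

lemma evalSingle_id (a : Strictification O) :
    (evalSingle (a := a) (b := a) (𝟙 a.as)).hom = hom (singleId a).hom ≫ (evalId a).hom := by
  simp [singleId]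

lemma evalSingle_comp (f : a.as ⟶ b.as) (g : b.as ⟶ c.as) :
    (evalSingle (a := a) (b := c) (f ≫ g)).hom =
      (hom (singleComp f g).hom ≫ (evalComp (single f : a ⟶ b) (single g : b ⟶ c)).hom) ≫
        eval (single f : a ⟶ b) ◁ (evalSingle g).hom ≫ (evalSingle f).hom ▷ g := by
  simp [singleComp]

end Strictification

section Icon

variable {a b c : O}

/-- The naturality constraint, with identity components, given by a 2-isomorphism. -/
abbrev iconIso {f g : a ⟶ b} (e : f ≅ g) : f ≫ 𝟙 b ≅ 𝟙 a ≫ g :=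
  Bicategory.rightUnitor f ≪≫ e ≪≫ (Bicategory.leftUnitor g).symm

/-- A strong transformation whose 1-morphism components are identities amounts to a family of
2-isomorphisms `e` compatible with 2-morphisms, identities and composition. These three lemmas
remove the unitors from the three axioms; `m` stands for the comparison 2-morphism of the source
pseudofunctor, while the target is an identity pseudofunctor. -/
lemma iconIso_naturality {f g f' g' : a ⟶ b} (e : f ≅ g) (e' : f' ≅ g') (η : f ⟶ f') (θ : g ⟶ g')
    (h : η ≫ e'.hom = e.hom ≫ θ) :
    η ▷ 𝟙 b ≫ (iconIso e').hom = (iconIso e).hom ≫ 𝟙 a ◁ θ := by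
  simp [reassoc_of% h]

lemma iconIso_id {f : a ⟶ a} (e : f ≅ 𝟙 a) (m : f ⟶ 𝟙 a) (h : e.hom = m) :
    (iconIso e).hom ≫ Bicategory.whiskerLeft (𝟙 a) (𝟙 (𝟙 a)) =
      Bicategory.whiskerRight m (𝟙 a) ≫ (Bicategory.leftUnitor (𝟙 a)).hom ≫
        (Bicategory.rightUnitor (𝟙 a)).inv := by
  simp [h, Bicategory.unitors_equal, Bicategory.unitors_inv_equal]

lemma iconIso_comp {f f' : a ⟶ b} {g g' : b ⟶ c} {l : a ⟶ c} (e : f ≅ f') (e' : g ≅ g')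
    (e'' : l ≅ f' ≫ g') (m : l ⟶ f ≫ g) (h : e''.hom = m ≫ f ◁ e'.hom ≫ e.hom ▷ g') :
    (iconIso e'').hom ≫ 𝟙 a ◁ 𝟙 (f' ≫ g') =
      m ▷ 𝟙 c ≫ (Bicategory.associator f g (𝟙 c)).hom ≫ f ◁ (iconIso e').hom ≫
        (Bicategory.associator f (𝟙 b) g').inv ≫ (iconIso e).hom ▷ g' ≫
          (Bicategory.associator (𝟙 a) f' g').hom := by
  simp [h]

end Icon

namespace Strictification

/-- Including paths after evaluating them is pseudo-naturally equivalent to the identity. -/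
def evalSingleTrans : Pseudofunctor.StrongTrans
    ((evalPseudofunctor O).comp (singlePseudofunctor O))
      (Pseudofunctor.id (Strictification O)) where
  app a := 𝟙 a
  naturality p := iconIso (isoMk (evalSingle (eval p)))
  naturality_naturality f := iconIso_naturality _ _ _ _ (singleMap_hom_naturality f)
  naturality_id a := iconIso_id _ _ (isoMk_evalSingle_id a)
  naturality_comp p q := iconIso_comp _ _ _ _ (isoMk_evalSingle_comp p q)

/-- Evaluating paths after including them is pseudo-naturally equivalent to the identity. -/
def singleEvalTrans : Pseudofunctor.StrongTrans
    ((singlePseudofunctor O).comp (evalPseudofunctor O)) (Pseudofunctor.id O) where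
  app a := 𝟙 a
  naturality {a b} f := iconIso (evalSingle (a := a) (b := b) f)
  naturality_naturality {a b _ _} η :=
    iconIso_naturality (O := O) _ _ _ _ (evalSingle_naturality (a := a) (b := b) η)
  naturality_id a := iconIso_id (O := O) _ _ (evalSingle_id (O := O) a)
  naturality_comp {a b c} f g :=
    iconIso_comp (O := O) _ _ _ _ (evalSingle_comp (a := a) (b := b) (c := c) f g)

end Strictification

end StrictificationEquivalence

/-! ### From a bicategory with suitable Hom-categories to a Morita context -/

section BicategoryToContext

open Bicategory

universe u₀

lemma ne_or_ne_of_ne {α : Type*} {i j l : α} (h : i ≠ l) : i ≠ j ∨ j ≠ l := by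
  by_contra! h'
  exact h (h'.1.trans h'.2)

lemma IsIdentity.symm {C : Type*} [Category* C] {X Y : C} {e : X ≅ Y} (h : IsIdentity e) :
    IsIdentity e.symm := by
  obtain ⟨rfl, rfl⟩ := h
  exact ⟨rfl, rfl⟩

variable (k : Type w) [Field k]

/-- The Hom-categories of a bicategory are finite linear categories, horizontal composition is
bilinear, right exact unless all three objects involved agree, and exact if the two outer objects
differ. -/
structure IsMoritaBicategory (O : Type u₀) [Bicategory.{v, u} O] [∀ i j : O, Abelian (i ⟶ j)]
    [∀ i j : O, Linear k (i ⟶ j)] : Prop where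
  finite (i j : O) : IsFiniteLinear k (i ⟶ j)
  precomp_additive {i j : O} (l : O) (f : i ⟶ j) : (precomp l f).Additive
  precomp_linear {i j : O} (l : O) (f : i ⟶ j) : (precomp l f).Linear k
  -- If `i = j = l` the composition is a tensor product, of which the definition asks bilinearity
  -- only. If `i = l ≠ j` it is a mixed product, hence right exact. If `i ≠ l` it is an action,
  -- hence exact.
  precomp_rightExact {i j : O} (l : O) (f : i ⟶ j) :
    i ≠ j ∨ j ≠ l → PreservesFiniteColimits (precomp l f)
  precomp_leftExact {i j : O} (l : O) (f : i ⟶ j) : i ≠ l → PreservesFiniteLimits (precomp l f)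
  postcomp_additive {j l : O} (i : O) (g : j ⟶ l) : (postcomp i g).Additive
  postcomp_linear {j l : O} (i : O) (g : j ⟶ l) : (postcomp i g).Linear k
  postcomp_rightExact {j l : O} (i : O) (g : j ⟶ l) :
    i ≠ j ∨ j ≠ l → PreservesFiniteColimits (postcomp i g)
  postcomp_leftExact {j l : O} (i : O) (g : j ⟶ l) : i ≠ l → PreservesFiniteLimits (postcomp i g)

variable {k}

namespace IsMoritaBicategory

variable {O : Type u₀} [Bicategory.{v, u} O] [∀ i j : O, Abelian (i ⟶ j)]
  [∀ i j : O, Linear k (i ⟶ j)] (h : IsMoritaBicategory k O)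

include h

lemma precomp_isRightExactLinear {i j : O} (l : O) (f : i ⟶ j) (hijl : i ≠ j ∨ j ≠ l) :
    IsRightExactLinear k (precomp l f) where
  additive := h.precomp_additive l f
  linear := h.precomp_linear l f
  rightExact := h.precomp_rightExact l f hijl

lemma precomp_isExactLinear {i j : O} (l : O) (f : i ⟶ j) (hil : i ≠ l) :
    IsExactLinear k (precomp l f) where
  toIsRightExactLinear := h.precomp_isRightExactLinear l f (ne_or_ne_of_ne hil)
  leftExact := h.precomp_leftExact l f hil

lemma postcomp_isRightExactLinear {j l : O} (i : O) (g : j ⟶ l) (hijl : i ≠ j ∨ j ≠ l) :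
    IsRightExactLinear k (postcomp i g) where
  additive := h.postcomp_additive i g
  linear := h.postcomp_linear i g
  rightExact := h.postcomp_rightExact i g hijl

lemma postcomp_isExactLinear {j l : O} (i : O) (g : j ⟶ l) (hil : i ≠ l) :
    IsExactLinear k (postcomp i g) where
  toIsRightExactLinear := h.postcomp_isRightExactLinear i g (ne_or_ne_of_ne hil)
  leftExact := h.postcomp_leftExact i g hil

/-- The Hom-categories as finite linear categories. -/
@[reducible]
def homCat (i j : O) : FinLinCat.{w, v, u} k where
  carrier := i ⟶ j
  finite := h.finite i j

lemma monoidalPreadditive (i : O) : MonoidalPreadditive (i ⟶ i) where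
  whiskerLeft_zero {f _ _} := have := h.precomp_additive i f; (precomp i f).map_zero _ _
  zero_whiskerRight {g _ _} := have := h.postcomp_additive i g; (postcomp i g).map_zero _ _
  whiskerLeft_add {f _ _} _ _ := (h.precomp_additive i f).map_add
  add_whiskerRight {g _ _} _ _ := (h.postcomp_additive i g).map_add

lemma monoidalLinear (i : O) :
    letI := h.monoidalPreadditive i
    MonoidalLinear k (i ⟶ i) :=
  letI := h.monoidalPreadditive i
  { whiskerLeft_smul := fun f _ _ c η => (h.precomp_linear i f).map_smul η c
    smul_whiskerRight := fun c _ _ η g => (h.postcomp_linear i g).map_smul η c }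

variable [∀ i : O, RigidCategory (i ⟶ i)]

/-- The endomorphism categories as finite multi-tensor categories. -/
@[reducible]
def endCat (i : O) : FinMultitensorCat.{w, v, u} k where
  toFinLinCat := h.homCat i i
  monoidal := inferInstanceAs (MonoidalCategory (i ⟶ i))
  monoidalPreadditive := h.monoidalPreadditive i
  monoidalLinear := h.monoidalLinear i
  rigid := inferInstanceAs (RigidCategory (i ⟶ i))

end IsMoritaBicategory

section Actions

variable {O : Type u₀} [Bicategory.{v, u} O]

lemma associator_naturality_three {a b c d : O} {x x' : a ⟶ b} {y y' : b ⟶ c} {z z' : c ⟶ d}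
    (f : x ⟶ x') (g : y ⟶ y') (h : z ⟶ z') :
    ((f ▷ y ≫ x' ◁ g) ▷ z ≫ (x' ≫ y') ◁ h) ≫ (Bicategory.associator x' y' z').hom =
      (Bicategory.associator x y z).hom ≫ f ▷ (y ≫ z) ≫ x' ◁ (g ▷ z ≫ y' ◁ h) := by
  simp

/-- This and the next two lemmas are the pentagon solved for one of its sides, as required by
`left_linear`, `balanced_right` and `MixedPentagon`. -/
lemma associator_inv_comp {a b c d e : O} (f : a ⟶ b) (g : b ⟶ c) (h : c ⟶ d) (l : d ⟶ e) :
    (Bicategory.associator (f ≫ g) h l).inv = (Bicategory.associator f g (h ≫ l)).hom ≫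
      f ◁ (Bicategory.associator g h l).inv ≫ (Bicategory.associator f (g ≫ h) l).inv ≫
        (Bicategory.associator f g h).inv ▷ l := by
  simp

lemma associator_inv_comp_middle {a b c d e : O} (f : a ⟶ b) (g : b ⟶ c) (h : c ⟶ d) (l : d ⟶ e) :
    (Bicategory.associator f (g ≫ h) l).inv = f ◁ (Bicategory.associator g h l).hom ≫
      (Bicategory.associator f g (h ≫ l)).inv ≫ (Bicategory.associator (f ≫ g) h l).inv ≫
        (Bicategory.associator f g h).hom ▷ l := by
  simp

lemma associator_eq {a b c d e : O} (f : a ⟶ b) (g : b ⟶ c) (h : c ⟶ d) (l : d ⟶ e) :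
    (Bicategory.associator f g h).inv ▷ l ≫ (Bicategory.associator (f ≫ g) h l).hom ≫
      (Bicategory.associator f g (h ≫ l)).hom ≫ f ◁ (Bicategory.associator g h l).inv =
        (Bicategory.associator f (g ≫ h) l).hom := by
  simp

lemma whiskerRight_whiskerRight_eq {a b c d : O} {f f' : a ⟶ b} (η : f ⟶ f') (g : b ⟶ c)
    (h : c ⟶ d) : η ▷ g ▷ h = (Bicategory.associator f g h).hom ≫ η ▷ (g ≫ h) ≫
      (Bicategory.associator f' g h).inv := by
  simp

lemma whiskerLeft_whiskerRight_eq {a b c d : O} (f : a ⟶ b) {g g' : b ⟶ c} (η : g ⟶ g')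
    (h : c ⟶ d) : f ◁ η ▷ h = (Bicategory.associator f g h).inv ≫ (f ◁ η) ▷ h ≫
      (Bicategory.associator f g' h).hom := by
  simp

lemma whiskerLeft_whiskerLeft_eq {a b c d : O} (f : a ⟶ b) (g : b ⟶ c) {h h' : c ⟶ d}
    (η : h ⟶ h') : f ◁ g ◁ η = (Bicategory.associator f g h).inv ≫ (f ≫ g) ◁ η ≫
      (Bicategory.associator f g h').hom := by
  simp

lemma hcomp_comp {a b c : O} {x x' x'' : a ⟶ b} {y y' y'' : b ⟶ c} (f : x ⟶ x') (f' : x' ⟶ x'')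
    (g : y ⟶ y') (g' : y' ⟶ y'') :
    (f ≫ f') ▷ y ≫ x'' ◁ (g ≫ g') = (f ▷ y ≫ x' ◁ g) ≫ f' ▷ y' ≫ x'' ◁ g' := by
  simp [Bicategory.whisker_exchange_assoc]

/-- The left action of endomorphisms by composition. -/
@[reducible]
def homLeftAction (i j : O) : MonoidalLeftAction (i ⟶ i) (i ⟶ j) where
  actionObj f g := f ≫ g
  actionHomLeft η g := η ▷ g
  actionHomRight f _ _ η := f ◁ η
  actionAssocIso f f' g := Bicategory.associator f f' g
  actionUnitIso g := Bicategory.leftUnitor g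
  actionHom_def _ _ := rfl
  actionHomRight_id f g := Bicategory.whiskerLeft_id f g
  id_actionHomLeft f g := Bicategory.id_whiskerRight f g
  actionHom_comp η η' θ θ' := hcomp_comp η η' θ θ'
  actionAssocIso_hom_naturality f g h := associator_naturality_three f g h
  actionUnitIso_hom_naturality η := (leftUnitor_naturality η).symm
  whiskerLeft_actionHomLeft f _ _ η g := Bicategory.whisker_assoc f η g
  whiskerRight_actionHomLeft f' η g := whiskerRight_whiskerRight_eq η f' g
  associator_actionHom f f' f'' g := Bicategory.pentagon f f' f'' g
  leftUnitor_actionHom f g := Bicategory.leftUnitor_whiskerRight f g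
  rightUnitor_actionHom f g := (Bicategory.triangle f g).symm

/-- The right action of endomorphisms by composition. -/
@[reducible]
def homRightAction (i j : O) : MonoidalRightAction (j ⟶ j) (i ⟶ j) where
  actionObj g f := g ≫ f
  actionHomLeft η f := η ▷ f
  actionHomRight g _ _ η := g ◁ η
  actionAssocIso g f f' := (Bicategory.associator g f f').symm
  actionUnitIso g := Bicategory.rightUnitor g
  actionHom_def _ _ := rfl
  actionHomRight_id f g := Bicategory.whiskerLeft_id g f
  id_actionHomLeft f g := Bicategory.id_whiskerRight g f
  actionHom_comp η η' θ θ' := hcomp_comp η η' θ θ'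
  actionAssocIso_hom_naturality f g h :=
    comp_inv_eq_inv_comp (associator_naturality_three f g h)
  actionUnitIso_hom_naturality η := (rightUnitor_naturality η).symm
  actionHomRight_whiskerRight η f g := whiskerLeft_whiskerRight_eq g η f
  whiskerRight_actionHomLeft f _ _ η g := whiskerLeft_whiskerLeft_eq g f η
  actionHom_associator f f' f'' g := pentagon_hom_inv_inv_inv_inv g f f' f''
  actionHom_leftUnitor f g := (triangle_assoc_comp_right g f).symm
  actionHom_rightUnitor f g := whiskerLeft_rightUnitor g f

end Actions

namespace IsMoritaBicategory

variable {O : Type u₀} [Bicategory.{v, u} O] [∀ i j : O, Abelian (i ⟶ j)]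
  [∀ i j : O, Linear k (i ⟶ j)] (h : IsMoritaBicategory k O) [∀ i : O, RigidCategory (i ⟶ i)]

/-- The Hom-categories as bimodule categories. -/
@[reducible]
def bimoduleCat {i j : O} (hij : i ≠ j) : BimoduleCat (h.endCat i) (h.endCat j) where
  toFinLinCat := h.homCat i j
  leftAction := homLeftAction i j
  rightAction := homRightAction i j
  leftAction_exact a := h.precomp_isExactLinear j a hij
  leftAction_exact' m := h.postcomp_isExactLinear i m hij
  rightAction_exact b := h.postcomp_isExactLinear i b hij
  rightAction_exact' m := h.precomp_isExactLinear j m hij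
  middle a m b := Bicategory.associator a m b
  middle_naturality f g h := associator_naturality_three f g h
  pentagon_left a a' m b := Bicategory.pentagon a a' m b
  pentagon_right a m b b' := (pentagon_hom_hom_inv_hom_hom a m b b').symm

/-- Composition as a mixed product. -/
@[reducible]
def mixedProduct {i j : O} (hij : i ≠ j) :
    MixedProduct (h.bimoduleCat hij) (h.bimoduleCat hij.symm) where
  functor := precomposing i j i
  rightExact m := h.precomp_isRightExactLinear i m (.inl hij)
  rightExact' n := h.postcomp_isRightExactLinear i n (.inl hij)
  leftIso a m n := (Bicategory.associator a m n).symm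
  rightIso m n a := Bicategory.associator m n a
  balancing m b n := Bicategory.associator m b n
  leftIso_naturality f g h := comp_inv_eq_inv_comp (associator_naturality_three f g h)
  rightIso_naturality f g h := associator_naturality_three f g h
  balancing_naturality f g h := associator_naturality_three f g h
  leftIso_pentagon a a' m n := (pentagon_hom_inv_inv_inv_hom a a' m n).symm
  rightIso_pentagon m n a a' := (pentagon_inv_hom_hom_hom_inv m n a a').symm
  bimodule_pentagon a m n a' := (pentagon_hom_hom_inv_inv_hom a m n a').symm
  balancing_pentagon m b b' n := (pentagon_inv_hom_hom_hom_hom m b b' n).symm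
  leftIso_balancing a m b n := pentagon_inv_inv_hom_hom_inv a m b n
  rightIso_balancing m b n a := (Bicategory.pentagon m b n a).symm

/-- The associator as a mixed associator. -/
@[reducible]
def mixedAssociator {i j : O} (hij : i ≠ j) :
    MixedAssociator (h.mixedProduct hij) (h.mixedProduct hij.symm) where
  iso m n m' := (Bicategory.associator m n m').symm
  naturality f g h := comp_inv_eq_inv_comp (associator_naturality_three f g h)
  left_linear a m n m' := associator_inv_comp a m n m'
  right_linear m n m' b := (pentagon_inv_inv_hom_hom_inv m n m' b).symm
  balanced_left m b n m' := (pentagon_hom_inv_inv_inv_hom m b n m').symm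
  balanced_right m n a m' := associator_inv_comp_middle m n a m'

lemma mixedPentagon {i j : O} (hij : i ≠ j) :
    MixedPentagon (h.mixedAssociator hij) (h.mixedAssociator hij.symm) :=
  fun m₁ n₁ m₂ n₂ => associator_eq m₁ n₁ m₂ n₂

/-- The Morita context formed by two different objects of a bicategory. -/
@[reducible]
def moritaContext {i j : O} (hij : i ≠ j) : MoritaContext.{w, v, u} k where
  A := h.endCat i
  B := h.endCat j
  M := h.bimoduleCat hij
  N := h.bimoduleCat hij.symm
  P := h.mixedProduct hij
  Q := h.mixedProduct hij.symm
  α := h.mixedAssociator hij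
  β := h.mixedAssociator hij.symm
  pentagon := h.mixedPentagon hij
  pentagon' := h.mixedPentagon hij.symm

/-- A bicategory whose constraints are identities gives a strict Morita context. -/
lemma moritaContext_isStrict {i j : O} (hij : i ≠ j)
    (hα : ∀ {a b c d : O} (x : a ⟶ b) (y : b ⟶ c) (z : c ⟶ d),
      IsIdentity (Bicategory.associator x y z))
    (hl : ∀ {a b : O} (x : a ⟶ b), IsIdentity (Bicategory.leftUnitor x))
    (hr : ∀ {a b : O} (x : a ⟶ b), IsIdentity (Bicategory.rightUnitor x)) :
    (h.moritaContext hij).IsStrict where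
  A := ⟨hα, hl, hr⟩
  B := ⟨hα, hl, hr⟩
  M := ⟨hα, hl, fun m b b' => (hα m b b').symm, hr, hα⟩
  N := ⟨hα, hl, fun m b b' => (hα m b b').symm, hr, hα⟩
  P := ⟨fun m b b' => (hα m b b').symm, hα, hα⟩
  Q := ⟨fun m b b' => (hα m b b').symm, hα, hα⟩
  α m n m' := (hα m n m').symm
  β m n m' := (hα m n m').symm

end IsMoritaBicategory

end BicategoryToContext

universe q

/-! ### Comparing the data of the resulting context with the bicategory it came from -/

section LinearData

set_option linter.checkUnivs false in
/-- The data of a two-object bicategory with linear Hom-categories. -/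
structure LinearBicategoryData (k : Type w) [Field k] extends BicategoryData.{v, u} Obj where
  preadditive i j : @Preadditive (Hom i j) (category i j)
  linear i j : @Linear k _ (Hom i j) (category i j) (preadditive i j)

variable {k : Type w} [Field k]

/-- The linear bicategory data of a Morita context. -/
@[reducible]
def MoritaContext.linearData (C : MoritaContext.{w, v, u} k) :
    LinearBicategoryData.{w, v, u} k where
  toBicategoryData := C.bicategoryData
  preadditive i j := (C.hom i j).abelian.toPreadditive
  linear i j := (C.hom i j).linear

/-- The linear bicategory data of a bicategory. -/
@[reducible]
def LinearBicategoryData.ofBicategory (k : Type w) [Field k] (S : Bicategory.{v, u} Obj)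
    (p : ∀ i j : Obj, Preadditive (i ⟶ j)) (l : ∀ i j : Obj, Linear k (i ⟶ j)) :
    LinearBicategoryData.{w, v, u} k where
  toBicategoryData := BicategoryData.ofBicategory S
  preadditive := p
  linear := l

/-- The Hom-categories of a context are defined by cases on `Obj`, so they agree with those of a
given bicategory only once the objects are concrete. Heterogeneous equality checked at the two
objects avoids explicit transports. -/
lemma heq_of_obj {β β' : Obj → Sort q} {f : ∀ i, β i} {f' : ∀ i, β' i}
    (h₀ : f .zero ≍ f' .zero) (h₁ : f .one ≍ f' .one) : f ≍ f' :=
  Function.hfunext rfl fun i _ hi => by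
    obtain rfl := eq_of_heq hi
    cases i
    exacts [h₀, h₁]

lemma LinearBicategoryData.ext_heq {X Y : LinearBicategoryData.{w, v, u} k} (h₁ : X.Hom = Y.Hom)
    (h₂ : X.category ≍ Y.category) (h₃ : X.id ≍ Y.id) (h₄ : @X.comp ≍ @Y.comp)
    (h₅ : @X.whiskerLeft ≍ @Y.whiskerLeft) (h₆ : @X.whiskerRight ≍ @Y.whiskerRight)
    (h₇ : @X.associator ≍ @Y.associator) (h₈ : @X.leftUnitor ≍ @Y.leftUnitor)
    (h₉ : @X.rightUnitor ≍ @Y.rightUnitor) (h₁₀ : X.preadditive ≍ Y.preadditive)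
    (h₁₁ : X.linear ≍ Y.linear) : X = Y := by
  obtain ⟨⟨H, c, i, m, wl, wr, a, lu, ru⟩, p, l⟩ := X
  obtain ⟨⟨H', c', i', m', wl', wr', a', lu', ru'⟩, p', l'⟩ := Y
  dsimp only at *
  subst h₁ h₂ h₃ h₄ h₅ h₆ h₇ h₈ h₉ h₁₀ h₁₁
  rfl

lemma IsMoritaBicategory.linearData_moritaContext [S : Bicategory.{v, u} Obj]
    [∀ i j : Obj, Abelian (i ⟶ j)] [∀ i j : Obj, Linear k (i ⟶ j)]
    [∀ i : Obj, RigidCategory (i ⟶ i)] (h : IsMoritaBicategory k Obj) :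
    (h.moritaContext (i := Obj.zero) (j := Obj.one) nofun).linearData =
      .ofBicategory k S (fun _ _ => inferInstance) (fun _ _ => inferInstance) := by
  refine LinearBicategoryData.ext_heq ?_ ?_ ?_ ?_ ?_ ?_ ?_ ?_ ?_ ?_ ?_
  · exact funext fun i => funext fun j => by cases i <;> cases j <;> rfl
  · exact heq_of_obj (heq_of_obj .rfl .rfl) (heq_of_obj .rfl .rfl)
  · exact heq_of_obj .rfl .rfl
  · exact heq_of_obj
      (heq_of_obj (heq_of_obj .rfl .rfl) (heq_of_obj .rfl .rfl))
      (heq_of_obj (heq_of_obj .rfl .rfl) (heq_of_obj .rfl .rfl))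
  · exact heq_of_obj
      (heq_of_obj (heq_of_obj .rfl .rfl) (heq_of_obj .rfl .rfl))
      (heq_of_obj (heq_of_obj .rfl .rfl) (heq_of_obj .rfl .rfl))
  · exact heq_of_obj
      (heq_of_obj (heq_of_obj .rfl .rfl) (heq_of_obj .rfl .rfl))
      (heq_of_obj (heq_of_obj .rfl .rfl) (heq_of_obj .rfl .rfl))
  · exact heq_of_obj
      (heq_of_obj
        (heq_of_obj (heq_of_obj .rfl .rfl) (heq_of_obj .rfl .rfl))
        (heq_of_obj (heq_of_obj .rfl .rfl) (heq_of_obj .rfl .rfl)))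
      (heq_of_obj
        (heq_of_obj (heq_of_obj .rfl .rfl) (heq_of_obj .rfl .rfl))
        (heq_of_obj (heq_of_obj .rfl .rfl) (heq_of_obj .rfl .rfl)))
  · exact heq_of_obj (heq_of_obj .rfl .rfl) (heq_of_obj .rfl .rfl)
  · exact heq_of_obj (heq_of_obj .rfl .rfl) (heq_of_obj .rfl .rfl)
  · exact heq_of_obj (heq_of_obj .rfl .rfl) (heq_of_obj .rfl .rfl)
  · exact heq_of_obj (heq_of_obj .rfl .rfl) (heq_of_obj .rfl .rfl)

lemma pseudoEquivalent_toBicategory (C : MoritaContext.{w, v, u} k) (S T : Bicategory.{v, u} Obj)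
    (p : ∀ i j : Obj, @Preadditive (T.Hom i j) (T.homCategory i j))
    (l : ∀ i j : Obj,
      @Linear k _ (T.Hom i j) (T.homCategory i j) (p i j))
    (p' : ∀ i j : Obj, @Preadditive (S.Hom i j) (S.homCategory i j))
    (l' : ∀ i j : Obj,
      @Linear k _ (S.Hom i j) (S.homCategory i j) (p' i j))
    (hC : C.linearData = .ofBicategory k S p' l')
    (hST : @PseudoEquivalent k _ Obj Obj T S p l p' l') :
    ∃ hD : C.bicategoryData.IsBicategory, @PseudoEquivalent k _ Obj Obj T hD.toBicategory p l
      (fun i j => (C.hom i j).abelian.toPreadditive) (fun i j => (C.hom i j).linear) := by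
  -- Neither side of `hC` is a variable. Once `C.linearData` is generalized to `D`, the equation can
  -- be substituted, and the bicategory rebuilt from the data of `S` is `S` definitionally.
  suffices ∀ (D : LinearBicategoryData.{w, v, u} k), D = .ofBicategory k S p' l' →
      ∃ hD : D.toBicategoryData.IsBicategory, @PseudoEquivalent k _ Obj Obj T hD.toBicategory p l
        D.preadditive D.linear from this _ hC
  rintro _ rfl
  exact ⟨⟨S, rfl⟩, hST⟩

end LinearData

/-! ### Exactness, linearity and rigidity in the bicategory of a context -/

section ContextToBicategory

open Bicategory

variable {k : Type w} [Field k]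

/-- Replace the tensor product of morphisms by the composite of whiskerings. -/
@[reducible]
def monoidalOfWhisker {X : Type*} [Category* X] (m : MonoidalCategory X) : MonoidalCategory X where
  tensorObj x y := x ⊗ y
  whiskerLeft x _ _ f := x ◁ f
  whiskerRight f y := f ▷ y
  tensorUnit := 𝟙_ X
  associator x y z := α_ x y z
  leftUnitor x := λ_ x
  rightUnitor x := ρ_ x
  tensorHom_comp_tensorHom f g h l := by
    simpa only [MonoidalCategory.tensorHom_def] using tensorHom_comp_tensorHom f g h l

lemma monoidalCategory_ext {X : Type*} [Category* X] {m m' : MonoidalCategory X}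
    (h : m.toMonoidalCategoryStruct = m'.toMonoidalCategoryStruct) : m = m' := by
  cases m
  cases m'
  dsimp only at h
  subst h
  rfl

/-- The endomorphism category of an object in a bicategory tensors morphisms by composing
whiskerings. In a given monoidal category this formula is only a provable equation, so rigidity has
to be transported along it. -/
lemma monoidalOfWhisker_eq {X : Type*} [Category* X] (m : MonoidalCategory X) :
    monoidalOfWhisker m = m := by
  refine monoidalCategory_ext ?_
  have h : @m.tensorHom =
      fun {x x' y y'} (f : x ⟶ x') (g : y ⟶ y') => m.whiskerRight f y ≫ m.whiskerLeft x' g := by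
    funext x x' y y' f g
    exact MonoidalCategory.tensorHom_def f g
  change ({ m.toMonoidalCategoryStruct with
    tensorHom := fun {x x' y y'} (f : x ⟶ x') (g : y ⟶ y') =>
      m.whiskerRight f y ≫ m.whiskerLeft x' g } : MonoidalCategoryStruct X) =
    { m.toMonoidalCategoryStruct with tensorHom := @m.tensorHom }
  rw [h]

/-- Rigidity does not depend on the tensor product of morphisms. -/
@[reducible]
def rigidCategoryOfWhisker {X : Type*} [Category* X] {m : MonoidalCategory X}
    (h : RigidCategory X) : @RigidCategory X _ (monoidalOfWhisker m) :=
  (monoidalOfWhisker_eq m).symm ▸ h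

namespace MoritaContext

variable (C : MoritaContext.{w, v, u} k)

/-- The endomorphism categories of the bicategory of a Morita context are rigid. -/
@[reducible]
def rigidEnd :
    letI := C.bicategory
    ∀ i : Obj, RigidCategory (i ⟶ i)
  | .zero => rigidCategoryOfWhisker C.A.rigid
  | .one => rigidCategoryOfWhisker C.B.rigid

/-- Precomposition with a 1-morphism. -/
@[reducible]
def precompFunctor {i j : Obj} (l : Obj) (f : C.hom i j) : C.hom j l ⥤ C.hom i l :=
  letI := C.bicategory
  precomp (a := i) (b := j) l f

/-- Postcomposition with a 1-morphism. -/
@[reducible]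
def postcompFunctor {j l : Obj} (i : Obj) (g : C.hom j l) : C.hom i j ⥤ C.hom i l :=
  letI := C.bicategory
  postcomp (b := j) (c := l) i g

lemma precomp_isExactLinear : ∀ {i j : Obj} (l : Obj) (f : C.hom i j), i ≠ l →
    IsExactLinear k (C.precompFunctor l f)
  | .zero, .zero, .one => fun f _ => C.M.leftAction_exact f
  | .zero, .one, .one => fun f _ => C.M.rightAction_exact' f
  | .one, .zero, .zero => fun f _ => C.N.rightAction_exact' f
  | .one, .one, .zero => fun f _ => C.N.leftAction_exact f
  | .zero, _, .zero => fun _ h => (h rfl).elim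
  | .one, _, .one => fun _ h => (h rfl).elim

lemma postcomp_isExactLinear : ∀ {j l : Obj} (i : Obj) (g : C.hom j l), i ≠ l →
    IsExactLinear k (C.postcompFunctor i g)
  | .zero, .one, .zero => fun f _ => C.M.leftAction_exact' f
  | .one, .one, .zero => fun f _ => C.M.rightAction_exact f
  | .zero, .zero, .one => fun f _ => C.N.rightAction_exact f
  | .one, .zero, .one => fun f _ => C.N.leftAction_exact' f
  | _, .zero, .zero => fun _ h => (h rfl).elim
  | _, .one, .one => fun _ h => (h rfl).elim

lemma precomp_isRightExactLinear : ∀ {i j : Obj} (l : Obj) (f : C.hom i j), i ≠ j ∨ j ≠ l →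
    IsRightExactLinear k (C.precompFunctor l f)
  | .zero, .one, .zero => fun f _ => C.P.rightExact f
  | .one, .zero, .one => fun f _ => C.Q.rightExact f
  | .zero, _, .one => fun f _ =>
      (C.precomp_isExactLinear (i := .zero) .one f nofun).toIsRightExactLinear
  | .one, _, .zero => fun f _ =>
      (C.precomp_isExactLinear (i := .one) .zero f nofun).toIsRightExactLinear
  | .zero, .zero, .zero => fun _ h => (h.elim (· rfl) (· rfl)).elim
  | .one, .one, .one => fun _ h => (h.elim (· rfl) (· rfl)).elim

lemma postcomp_isRightExactLinear : ∀ {j l : Obj} (i : Obj) (g : C.hom j l), i ≠ j ∨ j ≠ l →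
    IsRightExactLinear k (C.postcompFunctor i g)
  | .one, .zero, .zero => fun f _ => C.P.rightExact' f
  | .zero, .one, .one => fun f _ => C.Q.rightExact' f
  | _, .one, .zero => fun f _ =>
      (C.postcomp_isExactLinear (l := .one) .zero f nofun).toIsRightExactLinear
  | _, .zero, .one => fun f _ =>
      (C.postcomp_isExactLinear (l := .zero) .one f nofun).toIsRightExactLinear
  | .zero, .zero, .zero => fun _ h => (h.elim (· rfl) (· rfl)).elim
  | .one, .one, .one => fun _ h => (h.elim (· rfl) (· rfl)).elim

lemma precomp_additive : ∀ {i j : Obj} (l : Obj) (f : C.hom i j), (C.precompFunctor l f).Additive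
  | .zero, .zero, .zero => fun _ => ⟨MonoidalPreadditive.whiskerLeft_add _ _⟩
  | .one, .one, .one => fun _ => ⟨MonoidalPreadditive.whiskerLeft_add _ _⟩
  | .zero, .one, _ => fun f =>
      (C.precomp_isRightExactLinear (i := .zero) (j := .one) _ f (.inl nofun)).additive
  | .one, .zero, _ => fun f =>
      (C.precomp_isRightExactLinear (i := .one) (j := .zero) _ f (.inl nofun)).additive
  | .zero, .zero, .one => fun f =>
      (C.precomp_isRightExactLinear (i := .zero) (j := .zero) .one f (.inr nofun)).additive
  | .one, .one, .zero => fun f =>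
      (C.precomp_isRightExactLinear (i := .one) (j := .one) .zero f (.inr nofun)).additive

lemma precomp_linear : ∀ {i j : Obj} (l : Obj) (f : C.hom i j), (C.precompFunctor l f).Linear k
  | .zero, .zero, .zero => fun f => ⟨fun g c => MonoidalLinear.whiskerLeft_smul f c g⟩
  | .one, .one, .one => fun f => ⟨fun g c => MonoidalLinear.whiskerLeft_smul f c g⟩
  | .zero, .one, _ => fun f =>
      (C.precomp_isRightExactLinear (i := .zero) (j := .one) _ f (.inl nofun)).linear
  | .one, .zero, _ => fun f =>
      (C.precomp_isRightExactLinear (i := .one) (j := .zero) _ f (.inl nofun)).linear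
  | .zero, .zero, .one => fun f =>
      (C.precomp_isRightExactLinear (i := .zero) (j := .zero) .one f (.inr nofun)).linear
  | .one, .one, .zero => fun f =>
      (C.precomp_isRightExactLinear (i := .one) (j := .one) .zero f (.inr nofun)).linear

lemma postcomp_additive : ∀ {j l : Obj} (i : Obj) (g : C.hom j l), (C.postcompFunctor i g).Additive
  | .zero, .zero, .zero => fun _ => ⟨MonoidalPreadditive.add_whiskerRight _ _⟩
  | .one, .one, .one => fun _ => ⟨MonoidalPreadditive.add_whiskerRight _ _⟩
  | .zero, .one, _ => fun f =>
      (C.postcomp_isRightExactLinear (j := .zero) (l := .one) _ f (.inr nofun)).additive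
  | .one, .zero, _ => fun f =>
      (C.postcomp_isRightExactLinear (j := .one) (l := .zero) _ f (.inr nofun)).additive
  | .zero, .zero, .one => fun f =>
      (C.postcomp_isRightExactLinear (j := .zero) (l := .zero) .one f (.inl nofun)).additive
  | .one, .one, .zero => fun f =>
      (C.postcomp_isRightExactLinear (j := .one) (l := .one) .zero f (.inl nofun)).additive

lemma postcomp_linear : ∀ {j l : Obj} (i : Obj) (g : C.hom j l), (C.postcompFunctor i g).Linear k
  | .zero, .zero, .zero => fun f => ⟨fun g c => MonoidalLinear.smul_whiskerRight c g f⟩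
  | .one, .one, .one => fun f => ⟨fun g c => MonoidalLinear.smul_whiskerRight c g f⟩
  | .zero, .one, _ => fun f =>
      (C.postcomp_isRightExactLinear (j := .zero) (l := .one) _ f (.inr nofun)).linear
  | .one, .zero, _ => fun f =>
      (C.postcomp_isRightExactLinear (j := .one) (l := .zero) _ f (.inr nofun)).linear
  | .zero, .zero, .one => fun f =>
      (C.postcomp_isRightExactLinear (j := .zero) (l := .zero) .one f (.inl nofun)).linear
  | .one, .one, .zero => fun f =>
      (C.postcomp_isRightExactLinear (j := .one) (l := .one) .zero f (.inl nofun)).linear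

lemma isMoritaBicategory :
    @IsMoritaBicategory k _ Obj C.bicategory (fun i j => (C.hom i j).abelian)
      (fun i j => (C.hom i j).linear) :=
  letI := C.bicategory
  letI : ∀ i j : Obj, Abelian (i ⟶ j) := fun i j => (C.hom i j).abelian
  letI : ∀ i j : Obj, Linear k (i ⟶ j) := fun i j => (C.hom i j).linear
  { finite := fun i j => (C.hom i j).finite
    precomp_additive := C.precomp_additive
    precomp_linear := C.precomp_linear
    precomp_rightExact := fun l f h => (C.precomp_isRightExactLinear l f h).rightExact
    precomp_leftExact := fun l f h => (C.precomp_isExactLinear l f h).leftExact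
    postcomp_additive := C.postcomp_additive
    postcomp_linear := C.postcomp_linear
    postcomp_rightExact := fun l f h => (C.postcomp_isRightExactLinear l f h).rightExact
    postcomp_leftExact := fun l f h => (C.postcomp_isExactLinear l f h).leftExact }

end MoritaContext

end ContextToBicategory

/-! ### Transport of the linear, abelian and rigid structure to paths -/

section LinearStrictification

open Bicategory

universe u₀

variable {k : Type w} [Field k] {O : Type u₀} [Bicategory.{v, u} O]

namespace Strictification

/-- Composition of paths as an equivalence between Hom-categories. -/
@[reducible]
def evalFunctor (a b : Strictification O) : (a ⟶ b) ⥤ (a.as ⟶ b.as) where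
  obj p := eval p
  map f := hom f

/-- `evalFunctor` is fully faithful. -/
def fullyFaithfulEval (a b : Strictification O) : (evalFunctor a b).FullyFaithful where
  preimage f := homMk f

instance (a b : Strictification O) : (evalFunctor a b).IsEquivalence where
  faithful := (fullyFaithfulEval a b).faithful
  full := (fullyFaithfulEval a b).full
  essSurj := ⟨fun f => ⟨single f, ⟨evalSingle f⟩⟩⟩

lemma hom_whiskerLeft_comp_evalComp {a b c : Strictification O} (p : a ⟶ b) {q r : b ⟶ c}
    (f : q ⟶ r) :
    hom (p ◁ f) ≫ (evalComp p r).hom = (evalComp p q).hom ≫ eval p ◁ hom f := by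
  simp

lemma hom_whiskerRight_comp_evalComp {a b c : Strictification O} {q r : a ⟶ b} (f : q ⟶ r)
    (p : b ⟶ c) :
    hom (f ▷ p) ≫ (evalComp r p).hom = (evalComp q p).hom ≫ hom f ▷ eval p := by
  simp

lemma evalComp_associativity {a b c d : Strictification O} (p : a ⟶ b) (q : b ⟶ c) (r : c ⟶ d) :
    (evalComp p q).inv ▷ eval r ≫ (evalComp (p ≫ q) r).inv ≫
        hom (Bicategory.associator p q r).hom =
      (Bicategory.associator (eval p) (eval q) (eval r)).hom ≫
        eval p ◁ (evalComp q r).inv ≫ (evalComp p (q ≫ r)).inv := by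
  simp

lemma evalComp_left_unitality {a b : Strictification O} (p : a ⟶ b) :
    (Bicategory.leftUnitor (eval p)).hom =
      (evalId a).inv ▷ eval p ≫ (evalComp (𝟙 a) p).inv ≫ hom (Bicategory.leftUnitor p).hom := by
  simp

lemma evalComp_right_unitality {a b : Strictification O} (p : a ⟶ b) :
    (Bicategory.rightUnitor (eval p)).hom =
      eval p ◁ (evalId b).inv ≫ (evalComp p (𝟙 b)).inv ≫ hom (Bicategory.rightUnitor p).hom := by
  simp

/-- `evalFunctor` is compatible with precomposition. -/
def precompEvalIso {a b : Strictification O} (c : Strictification O) (p : a ⟶ b) :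
    precomp c p ⋙ evalFunctor a c ≅ evalFunctor b c ⋙ precomp c.as (eval p) :=
  NatIso.ofComponents (fun q => evalComp p q) (fun f => hom_whiskerLeft_comp_evalComp p f)

/-- `evalFunctor` is compatible with postcomposition. -/
def postcompEvalIso {b c : Strictification O} (a : Strictification O) (p : b ⟶ c) :
    postcomp a p ⋙ evalFunctor a c ≅ evalFunctor a b ⋙ postcomp a.as (eval p) :=
  NatIso.ofComponents (fun q => evalComp q p) (fun f => hom_whiskerRight_comp_evalComp f p)

section Linear

variable [∀ i j : O, Abelian (i ⟶ j)]

instance (a b : Strictification O) : Preadditive (a ⟶ b) :=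
  .ofFullyFaithful (fullyFaithfulEval a b)

instance (a b : Strictification O) : (evalFunctor a b).Additive :=
  (fullyFaithfulEval a b).additive_ofFullyFaithful

noncomputable instance (a b : Strictification O) : Abelian (a ⟶ b) :=
  have : HasFiniteProducts (a ⟶ b) :=
    ⟨fun _ => Adjunction.hasLimitsOfShape_of_equivalence (evalFunctor a b)⟩
  abelianOfEquivalence (evalFunctor a b)

variable [∀ i j : O, Linear k (i ⟶ j)]

instance (a b : Strictification O) : Linear k (a ⟶ b) where
  homModule _ _ :=
    { smul := fun c f => homMk (c • hom f)
      one_smul := fun f => hom_ext (one_smul k (hom f))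
      mul_smul := fun c d f => hom_ext (mul_smul c d (hom f))
      smul_zero := fun c => hom_ext (smul_zero c)
      smul_add := fun c f g => hom_ext (smul_add c (hom f) (hom g))
      add_smul := fun c d f => hom_ext (add_smul c d (hom f))
      zero_smul := fun f => hom_ext (zero_smul k (hom f)) }
  smul_comp _ _ _ c f g := hom_ext (Linear.smul_comp _ _ _ c (hom f) (hom g))
  comp_smul _ _ _ f c g := hom_ext (Linear.comp_smul _ _ _ (hom f) c (hom g))

instance (a b : Strictification O) : (evalFunctor a b).Linear k where

lemma isFiniteLinear (a b : Strictification O) (h : IsFiniteLinear k (a.as ⟶ b.as)) :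
    IsFiniteLinear k (a ⟶ b) := by
  obtain ⟨R, _, _, hR, e, _, _⟩ := h
  exact ⟨R, _, _, hR, (evalFunctor a b).asEquivalence.trans e,
    inferInstanceAs (evalFunctor a b ⋙ e.functor).Additive,
    inferInstanceAs ((evalFunctor a b ⋙ e.functor).Linear k)⟩

end Linear

/-- `evalFunctor` is monoidal on endomorphisms. -/
instance (a : Strictification O) : (evalFunctor a a).Monoidal :=
  Functor.CoreMonoidal.toMonoidal
    { εIso := (evalId a).symm
      μIso := fun p q => (evalComp p q).symm
      μIso_hom_natural_left := fun f p =>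
        comp_inv_eq_inv_comp (hom_whiskerRight_comp_evalComp f p)
      μIso_hom_natural_right := fun p f =>
        comp_inv_eq_inv_comp (hom_whiskerLeft_comp_evalComp p f)
      associativity := fun p q r => evalComp_associativity p q r
      left_unitality := fun p => evalComp_left_unitality p
      right_unitality := fun p => evalComp_right_unitality p }

/-- Duals are formed after evaluation and brought back along the monoidal equivalence `evalFunctor a
a`. -/
noncomputable instance [∀ i : O, RigidCategory (i ⟶ i)] (a : Strictification O) :
    RigidCategory (a ⟶ a) :=
  rigidCategoryOfEquivalence (F := evalFunctor a a) (evalFunctor a a).asEquivalence.toAdjunction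

end Strictification

section Transport

variable {X X' Y Y' : Type*} [Category* X] [Category* X'] [Category* Y] [Category* Y']
  {F : X ⥤ X'} {G : Y ⥤ Y'} {E : X ⥤ Y} {E' : X' ⥤ Y'} (e : F ⋙ E' ≅ E ⋙ G)

include e

/-- In these four lemmas `E` and `E'` play the role of evaluation on Hom-categories and `F`, `G`
that of composition with a path and with its composite. The property is detected after applying
`E'`, where `F` becomes isomorphic to `E ⋙ G`. -/
lemma additive_of_comp_iso [Preadditive X] [Preadditive X'] [Preadditive Y] [Preadditive Y']
    [E.Additive] [E'.Additive] [E'.Faithful] (h : G.Additive) : F.Additive where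
  map_add {x y f g} := E'.map_injective (by
    have : (F ⋙ E').Additive := Functor.additive_of_iso e.symm
    simpa using (F ⋙ E').map_add (f := f) (g := g))

lemma linear_of_comp_iso [Preadditive X] [Preadditive X'] [Preadditive Y] [Preadditive Y']
    [Linear k X] [Linear k X'] [Linear k Y] [Linear k Y']
    [E.Linear k] [E'.Linear k] [E'.Faithful] (h : G.Linear k) : F.Linear k where
  map_smul f c := E'.map_injective (by
    have : (F ⋙ E').Linear k := Functor.linear_of_iso k e.symm
    simpa using (F ⋙ E').map_smul c f)

lemma preservesFiniteColimits_of_comp_iso [E.IsEquivalence] [E'.IsEquivalence]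
    (h : PreservesFiniteColimits G) : PreservesFiniteColimits F := by
  have : PreservesFiniteColimits (F ⋙ E') := preservesFiniteColimits_of_natIso e.symm
  exact preservesFiniteColimits_of_reflects_of_preserves F E'

lemma preservesFiniteLimits_of_comp_iso [E.IsEquivalence] [E'.IsEquivalence]
    (h : PreservesFiniteLimits G) : PreservesFiniteLimits F := by
  have : PreservesFiniteLimits (F ⋙ E') := preservesFiniteLimits_of_natIso e.symm
  exact preservesFiniteLimits_of_reflects_of_preserves F E'

end Transport

open Strictification in
lemma IsMoritaBicategory.strictification [∀ i j : O, Abelian (i ⟶ j)]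
    [∀ i j : O, Linear k (i ⟶ j)] (h : IsMoritaBicategory k O) :
    IsMoritaBicategory k (Strictification O) where
  finite a b := isFiniteLinear a b (h.finite a.as b.as)
  precomp_additive c p := additive_of_comp_iso (precompEvalIso c p) (h.precomp_additive _ _)
  precomp_linear c p := linear_of_comp_iso (precompEvalIso c p) (h.precomp_linear _ _)
  precomp_rightExact c p hp :=
    preservesFiniteColimits_of_comp_iso (precompEvalIso c p) (h.precomp_rightExact _ _ hp)
  precomp_leftExact c p hp :=
    preservesFiniteLimits_of_comp_iso (precompEvalIso c p) (h.precomp_leftExact _ _ hp)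
  postcomp_additive c p := additive_of_comp_iso (postcompEvalIso c p) (h.postcomp_additive _ _)
  postcomp_linear c p := linear_of_comp_iso (postcompEvalIso c p) (h.postcomp_linear _ _)
  postcomp_rightExact c p hp :=
    preservesFiniteColimits_of_comp_iso (postcompEvalIso c p) (h.postcomp_rightExact _ _ hp)
  postcomp_leftExact c p hp :=
    preservesFiniteLimits_of_comp_iso (postcompEvalIso c p) (h.postcomp_leftExact _ _ hp)

end LinearStrictification

/-! ### The strict context and its equivalence with the original -/

section Main

open Bicategory

variable {k : Type w} [Field k]

lemma isEquivalenceOneMorphism_id {O : Type} [Bicategory.{v, u} O] (x : O) :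
    IsEquivalenceOneMorphism (𝟙 x) :=
  ⟨𝟙 x, ⟨Bicategory.leftUnitor _⟩, ⟨Bicategory.leftUnitor _⟩⟩

namespace Strictification

variable {O : Type} [Bicategory.{v, u} O] [∀ i j : O, Abelian (i ⟶ j)]
  [∀ i j : O, Linear k (i ⟶ j)] {a b : Strictification O} {f g : a.as ⟶ b.as}

lemma singleMap_add (η θ : f ⟶ g) :
    (singleMap (η + θ) : (single f : a ⟶ b) ⟶ _) = singleMap η + singleMap θ := by
  refine hom_ext ?_
  have h (x y : (single f : a ⟶ b) ⟶ single g) : hom (x + y) = hom x + hom y := rfl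
  rw [h]
  simp [singleMap]

lemma singleMap_smul (c : k) (η : f ⟶ g) :
    (singleMap (c • η) : (single f : a ⟶ b) ⟶ _) = c • singleMap η := by
  refine hom_ext ?_
  have h (x : (single f : a ⟶ b) ⟶ single g) : hom (c • x) = c • hom x := rfl
  rw [h]
  simp [singleMap]

end Strictification

lemma pseudoEquivalent_strictification (O : Type) [Bicategory.{v, u} O]
    [∀ i j : O, Abelian (i ⟶ j)] [∀ i j : O, Linear k (i ⟶ j)] :
    PseudoEquivalent k O (Strictification O) := by
  refine ⟨Strictification.singlePseudofunctor O, Strictification.evalPseudofunctor O, ?_, ?_,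
    ⟨Strictification.singleEvalTrans, fun x => isEquivalenceOneMorphism_id x⟩,
    ⟨Strictification.evalSingleTrans, fun x => isEquivalenceOneMorphism_id x⟩⟩
  · intro x y f g η θ c
    exact ⟨Strictification.singleMap_add (a := x) (b := y) η θ,
      Strictification.singleMap_smul (a := x) (b := y) c η⟩
  · exact fun x y f g η θ c => ⟨rfl, rfl⟩

/-- The strictification of a Morita context. -/
noncomputable def MoritaContext.strictification (C : MoritaContext.{w, v, u} k) :
    MoritaContext.{w, v, u} k :=
  let := C.bicategory
  let : ∀ i j : Obj, Abelian (i ⟶ j) := fun i j => (C.hom i j).abelian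
  let : ∀ i j : Obj, Linear k (i ⟶ j) := fun i j => (C.hom i j).linear
  let : ∀ i : Obj, RigidCategory (i ⟶ i) := C.rigidEnd
  C.isMoritaBicategory.strictification.moritaContext
    (i := (Obj.zero : Strictification Obj)) (j := (Obj.one : Strictification Obj)) nofun

namespace MoritaContext

variable (C : MoritaContext.{w, v, u} k)

lemma strictification_isStrict : C.strictification.IsStrict := by
  let := C.bicategory
  let : ∀ i j : Obj, Abelian (i ⟶ j) := fun i j => (C.hom i j).abelian
  let : ∀ i j : Obj, Linear k (i ⟶ j) := fun i j => (C.hom i j).linear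
  let : ∀ i : Obj, RigidCategory (i ⟶ i) := C.rigidEnd
  exact IsMoritaBicategory.moritaContext_isStrict _ _ Strictification.isIdentity_associator
    Strictification.isIdentity_leftUnitor Strictification.isIdentity_rightUnitor

lemma strictification_isTensor (h : C.IsTensor) : C.strictification.IsTensor := by
  let := C.bicategory
  let : ∀ i j : Obj, Abelian (i ⟶ j) := fun i j => (C.hom i j).abelian
  -- The unit is the empty path, which evaluates to the original unit, and evaluation reflects
  -- simplicity.
  have key (a : Strictification Obj) (ha : Simple (𝟙 a.as)) : Simple (𝟙 a) := by
    have : Simple ((Strictification.evalFunctor a a).obj (𝟙 a)) := ha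
    exact Functor.simple_of_simple_obj (Strictification.evalFunctor a a) _
  exact ⟨key _ h.1, key _ h.2⟩

lemma equivalent_strictification : C.Equivalent C.strictification := by
  let := C.bicategory
  let : ∀ i j : Obj, Abelian (i ⟶ j) := fun i j => (C.hom i j).abelian
  let : ∀ i j : Obj, Linear k (i ⟶ j) := fun i j => (C.hom i j).linear
  let : ∀ i : Obj, RigidCategory (i ⟶ i) := C.rigidEnd
  refine ⟨⟨C.bicategory, rfl⟩, ?_⟩
  exact pseudoEquivalent_toBicategory C.strictification
    Strictification.instBicategory C.bicategory _ _ _ _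
    (@IsMoritaBicategory.linearData_moritaContext k _ Strictification.instBicategory
      (fun (i j : Strictification Obj) => (inferInstance : Abelian (i ⟶ j)))
      (fun (i j : Strictification Obj) => (inferInstance : Linear k (i ⟶ j)))
      (fun (i : Strictification Obj) => (inferInstance : RigidCategory (i ⟶ i)))
      C.isMoritaBicategory.strictification)
    (pseudoEquivalent_strictification Obj)

end MoritaContext

end Main

end Morita

theorem mainTheorem9 (k : Type w) [Field k] [IsAlgClosed k] [CharZero k] :
    (∀ C : Morita.MoritaContext.{w, v, u} k,
      ∃ S : Bicategory.{v, u} Morita.Obj,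
        Morita.BicategoryData.ofBicategory S = C.bicategoryData) ∧
    (∀ C : Morita.MoritaContext.{w, v, u} k, ∃ C' : Morita.MoritaContext.{w, v, u} k,
      C'.IsStrict ∧ (C.IsTensor → C'.IsTensor) ∧ C.Equivalent C') :=
  ⟨fun C => ⟨C.bicategory, C.ofBicategory_bicategory⟩, fun C => ⟨C.strictification,
    C.strictification_isStrict, C.strictification_isTensor, C.equivalent_strictification⟩⟩
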